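/- Conventions. All schemes are excellent (every affine open is the spectrum of a Noetherian, universally catenary, J-2 ring whose local rings have geometrically regular formal fibres). For a normal scheme $X$ a divisor is a Weil divisor and a $\mathbb{Q}$-divisor is a Weil divisor with rational coefficients. Let $\Delta\ge 0$ be a $\mathbb{Q}$-divisor on $X$. The pair $(X,\Delta)$ is *globally $+$-regular* if for every finite dominant morphism $f\colon S\to X$ with $S$ normal, the natural map $\mathcal{O}_X\to f_*\mathcal{O}_S(\lfloor f^*\Delta\rfloor)$ splits as a map of $\mathcal{O}_X$-modules (here, as usual, $X$ and $S$ are integral; if $X$ is not integral, the condition is imposed for every integral normal $S$ and every finite $f$ whose image is an irreducible component of $X$, over that component). The pair $(X,\Delta)$ is *strongly globally $+$-regular* if for every effective divisor $D\ge 0$ on $X$ there is a rational number $\epsilon>0$ such that $(X,\Delta+\epsilon D)$ is globally $+$-regular. Proposition. Let $\pi\colon Y\to X$ be a proper (for example, projective) morphism of normal excellent schemes such that $\mathcal{O}_X\to\pi_*\mathcal{O}_Y$ is an isomorphism, and let $\Delta$ be an effective $\mathbb{Q}$-Cartier $\mathbb{Q}$-divisor on $X$. If $(Y,\pi^*\Delta)$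 is strongly globally $+$-regular, then $(X,\Delta)$ is strongly globally $+$-regular. -/

import Mathlib

open CategoryTheory AlgebraicGeometry TopologicalSpace TensorProduct

universe u

namespace PlusRegular

/-! ### Excellent rings and schemes -/

/-- `B` is catenary: any two saturated chains of primes with the same end points have the same
length. (This is used for Noetherian rings, where such chains have bounded length.) -/
def IsCatenary (B : Type u) [CommRing B] : Prop :=
  ∀ c c' : RelSeries {(p, q) : PrimeSpectrum B × PrimeSpectrum B | p ⋖ q},
    c.head = c'.head → c.last = c'.last → c.length = c'.length

/-- `A` is universally catenary: every `A`-algebra of finite type is catenary. -/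
def IsUniversallyCatenary (A : Type u) [CommRing A] : Prop :=
  ∀ (B : Type u) [CommRing B] [Algebra A B] [Algebra.FiniteType A B], IsCatenary B

/-- The formal fibres of the local ring `R` are geometrically regular: for every prime `q` of `R`
and every finite extension `k` of the residue field of `q`, the ring `k ⊗ R^` is regular, where
`R^` is the completion of `R` at its maximal ideal. -/
def HasGeometricallyRegularFormalFibres (R : Type u) [CommRing R] [IsLocalRing R] : Prop :=
  ∀ (q : Ideal R) [q.IsPrime] (k : Type u) [Field k] [Algebra q.ResidueField k] [Algebra R k]
    [IsScalarTower R q.ResidueField k] [FiniteDimensional q.ResidueField k],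
    IsRegularRing (k ⊗[R] AdicCompletion (IsLocalRing.maximalIdeal R) R)

/-- `A` is a G-ring: all its local rings have geometrically regular formal fibres. -/
def IsGRing (A : Type u) [CommRing A] : Prop :=
  ∀ (p : Ideal A) [p.IsPrime], HasGeometricallyRegularFormalFibres (Localization.AtPrime p)

/-- `A` is J-2: the regular locus of every `A`-algebra of finite type is open. -/
def IsJTwo (A : Type u) [CommRing A] : Prop :=
  ∀ (B : Type u) [CommRing B] [Algebra A B] [Algebra.FiniteType A B],
    IsOpen {P : PrimeSpectrum B | IsRegularLocalRing (Localization.AtPrime P.asIdeal)}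

/-- Excellent rings: Noetherian, universally catenary, G-ring, J-2. -/
structure IsExcellentRing (A : Type u) [CommRing A] : Prop where
  isNoetherianRing : IsNoetherianRing A
  isUniversallyCatenary : IsUniversallyCatenary A
  isGRing : IsGRing A
  isJTwo : IsJTwo A

/-- Excellent schemes: the coordinate ring of every affine open is excellent. -/
class IsExcellentScheme (X : Scheme.{u}) : Prop where
  isExcellentRing : ∀ U : X.Opens, IsAffineOpen U → IsExcellentRing Γ(X, U)

instance (X : Scheme.{u}) [IsExcellentScheme X] : IsLocallyNoetherian X where
  component_noetherian U := (IsExcellentScheme.isExcellentRing U.1 U.2).isNoetherianRing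

/-- Normal schemes: all local rings are integrally closed domains. -/
class IsNormalScheme (X : Scheme.{u}) : Prop where
  isDomain : ∀ x : X, IsDomain (X.presheaf.stalk x)
  isIntegrallyClosed : ∀ x : X, IsIntegrallyClosed (X.presheaf.stalk x)

/-! ### Divisors

Mathlib's `AlgebraicCycle X R` is the type of functions `X → R` with locally finite support, an
integral closed subset of `X` being identified with its generic point. The points of codimension
one are the points of coheight `1`. -/

/-- A cycle is a (Weil) divisor if it is supported in codimension one. With `R = ℤ` these are the
Weil divisors, with `R = ℚ` the `ℚ`-divisors. -/
def IsDivisor {X : Scheme.{u}} {R : Type*} [Zero R] (D : AlgebraicCycle X R) : Prop :=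
  ∀ x, D x ≠ 0 → Order.coheight x = 1

/-- The cycle `Δ + ε D`. -/
def perturb {X : Scheme.{u}} (Δ : AlgebraicCycle X ℚ) (ε : ℚ) (D : AlgebraicCycle X ℤ) :
    AlgebraicCycle X ℚ where
  toFun x := Δ x + ε * (D x : ℚ)
  supportWithinDomain' := by simp
  supportLocallyFiniteWithinDomain' z hz := by
    obtain ⟨s, hs, hs'⟩ := Δ.supportLocallyFiniteWithinDomain z hz
    obtain ⟨t, ht, ht'⟩ := D.supportLocallyFiniteWithinDomain z hz
    refine ⟨s ∩ t, Filter.inter_mem hs ht, (hs'.union ht').subset ?_⟩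
    rintro x ⟨⟨h1, h2⟩, h3⟩
    by_cases h : Δ x = 0
    · refine Or.inr ⟨h2, fun h0 => h3 ?_⟩
      simp [h, h0]
    · exact Or.inl ⟨h1, h⟩

/-- The section `g ∈ Γ(X, U)` has nonzero germs and `m Δ = div g` on `U`. The order of `g` at a
point `x` of codimension one is the length of `𝒪_{X,x} / (g)`. -/
structure IsLocalEquation {X : Scheme.{u}} (Δ : AlgebraicCycle X ℚ) (m : ℕ) (U : X.Opens)
    (g : Γ(X, U)) : Prop where
  germ_ne_zero : ∀ (x : X) (hx : x ∈ U), X.presheaf.germ U x hx g ≠ 0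
  eq_ord : ∀ (x : X) (hx : x ∈ U), Order.coheight x = 1 →
    (m : ℚ) * Δ x = ((Ring.ord (X.presheaf.stalk x) (X.presheaf.germ U x hx g)).toNat : ℚ)

/-- `Δ` is an effective `ℚ`-Cartier `ℚ`-divisor on the normal scheme `X`: for some `m > 0`, the
divisor `m Δ` is an effective Cartier divisor, i.e. it is locally the divisor of a
nonzerodivisor. -/
structure IsEffectiveQCartier {X : Scheme.{u}} (Δ : AlgebraicCycle X ℚ) : Prop where
  isDivisor : IsDivisor Δ
  nonneg : 0 ≤ Δ
  exists_isLocalEquation : ∃ m : ℕ, 0 < m ∧ ∀ x : X, ∃ (U : X.Opens) (g : Γ(X, U)),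
    x ∈ U ∧ IsLocalEquation Δ m U g

/-- `Δ'` is the pullback `π^* Δ` of the effective `ℚ`-Cartier `ℚ`-divisor `Δ` along `π : Y ⟶ X`:
it is a `ℚ`-divisor and its multiplicity at a point `y` of codimension one is `1 / m` times the
order at `y` of the pullback of a local equation of `m Δ` near `π y`. -/
structure IsQCartierPullback {X Y : Scheme.{u}} (π : Y ⟶ X) (Δ : AlgebraicCycle X ℚ)
    (Δ' : AlgebraicCycle Y ℚ) : Prop where
  isDivisor : IsDivisor Δ'
  eq_ord : ∀ (y : Y), Order.coheight y = 1 → ∀ (m : ℕ), 0 < m → ∀ (U : X.Opens) (g : Γ(X, U))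
    (hy : π y ∈ U), IsLocalEquation Δ m U g →
    (m : ℚ) * Δ' y = ((Ring.ord (Y.presheaf.stalk y)
      (π.stalkMap y (X.presheaf.germ U (π y) hy g))).toNat : ℚ)

/-- The multiplicity of `f^* Δ` at a point `s` of codimension one, for a finite dominant morphism
`f : S ⟶ X` of normal schemes: the multiplicity of `Δ` at `f s` times the ramification index
`length (𝒪_{S,s} / 𝔪_{f s} 𝒪_{S,s})` of `𝒪_{X,f s} → 𝒪_{S,s}`. -/
noncomputable def pullbackMult {S X : Scheme.{u}} (f : S ⟶ X) (Δ : AlgebraicCycle X ℚ) (s : S) :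
    ℚ :=
  ((Module.length (S.presheaf.stalk s) (S.presheaf.stalk s ⧸
    (IsLocalRing.maximalIdeal (X.presheaf.stalk (f s))).map (f.stalkMap s).hom)).toNat : ℚ)
    * Δ (f s)

theorem isDiscreteValuationRing_stalk (S : Scheme.{u}) [IsLocallyNoetherian S]
    [IsNormalScheme S] {s : S} (hs : Order.coheight s = 1) [IsDomain (S.presheaf.stalk s)] :
    IsDiscreteValuationRing (S.presheaf.stalk s) := by
  have h1 : ringKrullDim (S.presheaf.stalk s) = 1 := by
    rw [ringKrullDim_stalk_eq_coheight, hs]; rfl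
  have hf : ¬ IsField (S.presheaf.stalk s) := fun h => by
    rw [ringKrullDim_eq_zero_of_isField h] at h1
    exact zero_ne_one h1
  have := IsNormalScheme.isIntegrallyClosed s
  have : Ring.KrullDimLE 1 (S.presheaf.stalk s) := krullDimLE_of_coheight_le hs.le
  have hd : IsDedekindDomain (S.presheaf.stalk s) := by
    have : Ring.DimensionLEOne (S.presheaf.stalk s) :=
      ⟨fun {p} h0 hp => (Ring.krullDimLE_one_iff_of_noZeroDivisors.mp this p h0 hp)⟩
    exact { }
  exact ((IsDiscreteValuationRing.TFAE _ hf).out 2 0).mp hd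

/-- The sections over the nonempty open set `V` of the divisorial sheaf `𝒪_S(E)` on a normal
integral scheme `S`, for a function `E : S → ℤ` of which only the values at points of codimension
one matter: the rational functions `φ` such that `φ = 0` or `div φ + E ≥ 0` on `V`. -/
noncomputable def divisorialSections (S : Scheme.{u}) [IsIntegral S] [IsLocallyNoetherian S]
    [IsNormalScheme S] (E : S → ℤ) (V : S.Opens) [Nonempty V] :
    Submodule Γ(S, V) S.functionField where
  carrier := {φ | φ ≠ 0 → ∀ s ∈ V, Order.coheight s = 1 → 0 ≤ Scheme.ord φ s + E s}
  zero_mem' := fun h => absurd rfl h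
  add_mem' := by
    intro φ ψ hφ hψ h s hs h1
    have := IsNormalScheme.isDomain s
    have := isDiscreteValuationRing_stalk S h1
    by_cases hφ0 : φ = 0
    · simp only [hφ0, zero_add] at h ⊢
      exact hψ h s hs h1
    by_cases hψ0 : ψ = 0
    · simp only [hψ0, add_zero] at h ⊢
      exact hφ h s hs h1
    have h2 := Scheme.ord_add (x := s) h
    have h3 := hφ hφ0 s hs h1
    have h4 := hψ hψ0 s hs h1
    omega
  smul_mem' := by
    intro a φ hφ h s hs h1
    have ha : a ≠ 0 := by rintro rfl; simp at h
    have hφ0 : φ ≠ 0 := by rintro rfl; simp at h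
    have h2 := Scheme.ord_le_smul hs ha φ
    have h3 := hφ hφ0 s hs h1
    omega

theorem divisorialSections_mono (S : Scheme.{u}) [IsIntegral S] [IsLocallyNoetherian S]
    [IsNormalScheme S] (E : S → ℤ) {V W : S.Opens} [Nonempty V] [Nonempty W] (h : W ≤ V)
    {φ : S.functionField} (hφ : φ ∈ divisorialSections S E V) : φ ∈ divisorialSections S E W :=
  fun h0 s hs => hφ h0 s (h hs)

/-! ### Globally `+`-regular pairs -/

/-- For a finite morphism `f : S ⟶ X` from a normal integral scheme whose image is an irreducible
component `X₀` of the normal scheme `X` (so `X₀` is open, and `X₀ = X` if `X` is integral), this is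
a splitting of `𝒪_X → f_* 𝒪_S(⌊f^* Δ⌋)` over `X₀` as a map of `𝒪_X`-modules: a family of additive
maps `Γ(f⁻¹ U, 𝒪_S(⌊f^* Δ⌋)) → Γ(U, 𝒪_X)` for the nonempty open sets `U ⊆ X₀`, which is linear over
`𝒪_X`, compatible with restrictions and maps `1` to `1`. -/
structure Splitting {S X : Scheme.{u}} [IsIntegral S] [IsLocallyNoetherian S] [IsNormalScheme S]
    (f : S ⟶ X) (Δ : AlgebraicCycle X ℚ) where
  /-- The map on sections over `U`. -/
  toHom : ∀ (U : X.Opens) [Nonempty (f ⁻¹ᵁ U)], (U : Set X) ⊆ Set.range f →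
    divisorialSections S (fun s => ⌊pullbackMult f Δ s⌋) (f ⁻¹ᵁ U) →+ Γ(X, U)
  map_smul : ∀ (U : X.Opens) [Nonempty (f ⁻¹ᵁ U)] (hU : (U : Set X) ⊆ Set.range f) (a : Γ(X, U))
    (φ : divisorialSections S (fun s => ⌊pullbackMult f Δ s⌋) (f ⁻¹ᵁ U)),
    toHom U hU (f.app U a • φ) = a * toHom U hU φ
  map_restrict : ∀ (U V : X.Opens) [Nonempty (f ⁻¹ᵁ U)] [Nonempty (f ⁻¹ᵁ V)]
    (hU : (U : Set X) ⊆ Set.range f) (hV : (V : Set X) ⊆ Set.range f) (i : V ⟶ U)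
    (φ : divisorialSections S (fun s => ⌊pullbackMult f Δ s⌋) (f ⁻¹ᵁ U)),
    toHom V hV ⟨φ, divisorialSections_mono S _ (fun _ h => i.le h) φ.2⟩ =
      X.presheaf.map i.op (toHom U hU φ)
  map_one : ∀ (U : X.Opens) [Nonempty (f ⁻¹ᵁ U)] (hU : (U : Set X) ⊆ Set.range f),
    ∃ h : (1 : S.functionField) ∈
      divisorialSections S (fun s => ⌊pullbackMult f Δ s⌋) (f ⁻¹ᵁ U), toHom U hU ⟨1, h⟩ = 1

/-- The pair `(X, Δ)`, with `X` normal and `Δ` an effective `ℚ`-divisor, is globally `+`-regular: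
for every finite dominant morphism `f : S ⟶ X` with `S` normal, `𝒪_X → f_* 𝒪_S(⌊f^* Δ⌋)` splits.
Here `S` is integral and dominates an irreducible component of `X`; if `X` is integral, this just
says that `f` is dominant. -/
def IsGloballyPlusRegular (X : Scheme.{u}) (Δ : AlgebraicCycle X ℚ) : Prop :=
  ∀ (S : Scheme.{u}) [IsIntegral S] [IsLocallyNoetherian S] [IsNormalScheme S] (f : S ⟶ X)
    [IsFinite f], Set.range f ∈ irreducibleComponents X → Nonempty (Splitting f Δ)

/-- `(X, Δ)` is strongly globally `+`-regular: for every effective divisor `D` there is `ε > 0`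
such that `(X, Δ + ε D)` is globally `+`-regular. -/
def IsStronglyGloballyPlusRegular (X : Scheme.{u}) (Δ : AlgebraicCycle X ℚ) : Prop :=
  ∀ D : AlgebraicCycle X ℤ, IsDivisor D → 0 ≤ D →
    ∃ ε : ℚ, 0 < ε ∧ IsGloballyPlusRegular X (perturb Δ ε D)

end PlusRegular

/-! ### Noetherian normal domains are determined in height one -/

section Hartogs

variable {A K : Type*} [CommRing A] [IsDomain A] [IsNoetherianRing A] [IsIntegrallyClosed A]
  [Field K] [Algebra A K] [IsFractionRing A K]

/-! The splitting on `X` is obtained from one on `Y`. Given `D` on `X`, pick an effective divisor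
`E` on `Y` whose multiplicity at each codimension one point `y` is the order of the pullback of some
section `a` near `π y` with `D ≤ div a` (`exists_isPullbackBound`). The `ε` that works for `E` on
`Y` also works for `D` on `X`. Let `f : S ⟶ X` be a finite normal cover of a component. The equality
`𝒪_X = π_* 𝒪_Y` makes the preimage of that component a single component of `Y`. Normalizing it in a
compositum `L` of its function field and that of `S` gives a finite cover `g : T ⟶ Y` and an
embedding `μ` of `K(S)` into `K(T)` (`exists_finite_normal_cover`).

The main point is that `μ` sends sections of `𝒪_S(⌊f^*(Δ + εD)⌋)` to sections of `𝒪_T(⌊g^*(π^*Δ +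
εE)⌋)` (`mem_divisorialSections_of_cover`). Multiplying a power of a section `φ` by powers of local
equations of `mΔ` and of `a` clears floors and denominators. The product is regular in codimension
one on `S`, hence regular (`IsIntegrallyClosed.mem_range_algebraMap_of_height_eq_one`), hence
integral over `X`. Its image is then integral over `T`, so has nonnegative orders there, and this
inequality is the one wanted. Composing `μ`, the splitting on `Y` and the inverse of `𝒪_X → π_* 𝒪_Y`
splits the map on `X` (`nonempty_splitting_of_cover`).

Finiteness of `g` is where excellence enters, as finiteness of integral closure
(`finite_integralClosure`). In a normal closure the extension is purely inseparable followed by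
Galois, and the Galois step is classical. In the purely inseparable case a common denominator for
the integral closure is needed. At all but finitely many height one primes the J-2 condition
supplies it; at each remaining one it comes from reducedness of the formal fibre and a Chevalley
type argument (`exists_smul_mem_span_of_isReduced`). Regularity in height one then globalizes the
bound. -/

theorem IsIntegrallyClosed.height_eq_one_of_isAssociatedPrime {b : A} (hb : b ≠ 0) {P : Ideal A}
    (hP : IsAssociatedPrime P (A ⧸ Ideal.span {b})) : P.height = 1 := by
  obtain ⟨hPp, y', hy'⟩ := isAssociatedPrime_iff.mp hP
  obtain ⟨y, rfl⟩ := Ideal.Quotient.mk_surjective y'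
  have hmem (r : A) : r ∈ P ↔ b ∣ r * y := by
    rw [hy', Submodule.mem_colon_singleton, Submodule.mem_bot, Algebra.smul_def,
      Ideal.Quotient.algebraMap_eq, ← map_mul, Ideal.Quotient.eq_zero_iff_mem,
      Ideal.mem_span_singleton]
  have hbP : b ∈ P := (hmem b).2 (dvd_mul_right _ _)
  have hP0 : P ≠ ⊥ := by rintro rfl; exact hb hbP
  have hb' : algebraMap A (FractionRing A) b ≠ 0 := by simpa using hb
  -- Multiplication by `y / b` maps `P` into `A`. If it mapped `P` into itself, `y / b` would be
  -- integral by the determinant trick, hence in `A`, and then `1 ∈ P`. So some `r₀ ∈ P` is sent to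
  -- an element `c ∉ P`.
  have hJ : ∃ r₀ ∈ P, ∃ c ∉ P, r₀ * y = c * b := by
    by_contra! hJ
    have hint : IsIntegral A (algebraMap A (FractionRing A) y / algebraMap A _ b) := by
      refine isIntegral_of_smul_mem_submodule
        (Submodule.map (Algebra.linearMap A (FractionRing A)) P) ?_ ?_ _ ?_
      · exact fun h => hP0 (Submodule.map_injective_of_injective
          (f := Algebra.linearMap A (FractionRing A)) (IsFractionRing.injective A _)
          (h.trans (Submodule.map_bot _).symm))
      · exact (IsNoetherian.noetherian P).map _
      · rintro _ ⟨r, hr, rfl⟩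
        obtain ⟨c, hc⟩ := (hmem r).1 hr
        refine ⟨c, ?_, ?_⟩
        · by_contra hcP
          exact hJ r hr c hcP (by rw [hc, mul_comm])
        · rw [Algebra.linearMap_apply, Algebra.linearMap_apply, smul_eq_mul, div_mul_eq_mul_div,
            eq_div_iff hb', ← map_mul, ← map_mul, mul_comm y, hc, mul_comm]
    obtain ⟨z, hz⟩ := IsIntegrallyClosed.isIntegral_iff.mp hint
    rw [eq_div_iff hb', ← map_mul] at hz
    have := IsFractionRing.injective A (FractionRing A) hz
    refine hPp.ne_top ((Ideal.eq_top_iff_one _).2 ((hmem 1).2 ⟨z, ?_⟩))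
    rw [one_mul, ← this, mul_comm]
  obtain ⟨r₀, hr₀, c, hc, hrc⟩ := hJ
  -- Every `r ∈ P` satisfies `c r = r₀ d` with `c ∉ P`, so a prime inside `P` containing `r₀` is all
  -- of `P`. Krull's principal ideal theorem then bounds the height.
  have hmin : P ∈ (Ideal.span {r₀}).minimalPrimes := by
    refine ⟨⟨hPp, by simpa [Ideal.span_le] using hr₀⟩, ?_⟩
    rintro Q ⟨hQ, hQr⟩ hQP r hr
    obtain ⟨d, hd⟩ := (hmem r).1 hr
    have h1 : c * r = r₀ * d := by
      refine mul_right_cancel₀ hb ?_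
      linear_combination r * (-hrc) + r₀ * hd
    have h2 : c * r ∈ Q := by
      rw [h1]; exact Q.mul_mem_right _ (hQr (Ideal.mem_span_singleton_self _))
    exact (hQ.mem_or_mem h2).resolve_left fun h => hc (hQP h)
  refine le_antisymm (Ideal.height_le_one_of_isPrincipal_of_mem_minimalPrimes _ _ hmin) ?_
  rw [Order.one_le_iff_ne_zero, Ne, Ideal.height_eq_zero_iff_eq_bot]
  exact hP0

/-- An element of the fraction field of a Noetherian normal domain that is regular in height one
is regular. -/
theorem IsIntegrallyClosed.mem_range_algebraMap_of_height_eq_one {x : K}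
    (hx : ∀ p : Ideal A, p.IsPrime → p.height = 1 → ∃ s ∉ p, ∃ a, s • x = algebraMap A K a) :
    x ∈ (algebraMap A K).range := by
  obtain ⟨a, b, hb, rfl⟩ := IsFractionRing.div_surjective (A := A) x
  have hb0 : b ≠ 0 := nonZeroDivisors.ne_zero hb
  have hb' : algebraMap A K b ≠ 0 := by simpa using hb0
  by_contra hx0
  have ha : Ideal.Quotient.mk (Ideal.span {b}) a ≠ 0 := by
    rw [Ne, Ideal.Quotient.eq_zero_iff_mem, Ideal.mem_span_singleton]
    rintro ⟨c, rfl⟩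
    exact hx0 ⟨c, by rw [map_mul, mul_div_cancel_left₀ _ hb']⟩
  -- The annihilator of the nonzero class of `a` modulo `b` lies in an associated prime, which has
  -- height one. The hypothesis at that prime gives `s` outside it that kills the class.
  obtain ⟨P, hP, hle⟩ := exists_le_isAssociatedPrime_of_isNoetherianRing A _ ha
  obtain ⟨s, hs, c, hc⟩ := hx P hP.isPrime (height_eq_one_of_isAssociatedPrime hb0 hP)
  refine hs (hle ?_)
  rw [Submodule.mem_colon_singleton, Submodule.mem_bot, Algebra.smul_def,
    Ideal.Quotient.algebraMap_eq, ← map_mul, Ideal.Quotient.eq_zero_iff_mem,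
    Ideal.mem_span_singleton]
  refine ⟨c, IsFractionRing.injective A K ?_⟩
  rw [Algebra.smul_def, ← mul_div_assoc, div_eq_iff hb'] at hc
  rw [map_mul, hc, map_mul, mul_comm]

end Hartogs

/-! ### A form of Chevalley's theorem on decreasing sequences of submodules -/

/-- A Mittag-Leffler argument: the Artinian condition makes the images of the `I N` in each `M ⧸ T
j` stabilize, so an element of the stable image outside `T k` can be lifted level by level. The
sequence is Cauchy for `T`, with nonzero class modulo `T k`, and would converge into the closure of
every `I N`; since `M` need not be complete, only the sequence is produced. -/
theorem Submodule.exists_seq_of_antitone {R M : Type*} [CommRing R] [AddCommGroup M] [Module R M]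
    {I T : ℕ → Submodule R M} (hI : Antitone I) (hT : Antitone T)
    (hart : ∀ j, IsArtinian R (M ⧸ T j)) {k : ℕ} (hk : ∀ N, ¬ I N ≤ T k) :
    ∃ y : ℕ → M, y 0 ∉ T k ∧ (∀ n, y (n + 1) - y n ∈ T (k + n)) ∧ ∀ n N, y n ∈ I N ⊔ T n := by
  have hstab (j : ℕ) : ∃ n, ∀ N, I n ≤ I N ⊔ T j := by
    obtain ⟨n, hn⟩ := IsArtinian.monotone_stabilizes (R := R) (M := M ⧸ T j)
      ⟨fun N => OrderDual.toDual ((I N).map (T j).mkQ), fun a b h =>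
        Submodule.map_mono (hI h)⟩
    refine ⟨n, fun N => ?_⟩
    rcases le_total n N with h | h
    · have h1 : (I n).map (T j).mkQ = (I N).map (T j).mkQ := hn N h
      rw [sup_comm, ← Submodule.comap_map_mkQ, ← h1]
      exact Submodule.le_comap_map _ _
    · exact (hI h).trans le_sup_left
  choose s hs using hstab
  obtain ⟨y₀, hy₀, hy₀'⟩ := SetLike.not_le_iff_exists.mp (hk (s k))
  -- The lift: modulo `T j`, replace `x` by a representative in `I (s (j + 1))`, which automatically
  -- lies in the stable image modulo `T (j + 1)`.
  have step (j : ℕ) (x : M) (hx : ∀ N, x ∈ I N ⊔ T j) :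
      ∃ x', x' - x ∈ T j ∧ ∀ N, x' ∈ I N ⊔ T (j + 1) := by
    obtain ⟨i, hi, t, ht, rfl⟩ := Submodule.mem_sup.mp (hx (s (j + 1)))
    exact ⟨i, by simpa using ht, fun N => hs (j + 1) N hi⟩
  choose! g hg hg' using step
  let z : ℕ → M := fun n => Nat.rec y₀ (fun n x => g (k + n) x) n
  have hz (n : ℕ) : ∀ N, z n ∈ I N ⊔ T (k + n) := by
    induction n with
    | zero => exact fun N => hs k N hy₀
    | succ n ih => exact hg' (k + n) _ ih
  refine ⟨z, hy₀', fun n => hg (k + n) _ (hz n), fun n N => ?_⟩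
  exact sup_le_sup_left (hT (Nat.le_add_left n k)) _ (hz n N)

/-! ### Purely inseparable extensions of discrete valuation rings -/

section DVR

variable {R K L ι : Type*} [CommRing R] [IsDomain R] [IsDiscreteValuationRing R]
  [Field K] [Algebra R K] [IsFractionRing R K] [Field L] [Algebra K L] [Algebra R L]
  [IsScalarTower R K L] [Fintype ι]

theorem exists_algebraMap_pow_eq {A K L : Type*} [CommRing A] [IsDomain A]
    [IsIntegrallyClosed A] [Field K] [Algebra A K] [IsFractionRing A K] [Field L] [Algebra K L]
    [Algebra A L] [IsScalarTower A K L] {q : ℕ} (hq : ∀ x : L, x ^ q ∈ (algebraMap K L).range)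
    {x : L} (hx : IsIntegral A x) : ∃ a : A, algebraMap A L a = x ^ q := by
  obtain ⟨k, hk⟩ := hq x
  have h : IsIntegral A k := by
    rw [← isIntegral_algebraMap_iff (B := L) (algebraMap K L).injective, hk]
    exact hx.pow q
  obtain ⟨a, rfl⟩ := IsIntegrallyClosed.isIntegral_iff.mp h
  exact ⟨a, by rw [← hk, ← IsScalarTower.algebraMap_apply]⟩

theorem exists_smul_mem_span {A K L ι : Type*} [CommRing A] [IsDomain A]
    [Field K] [Algebra A K] [IsFractionRing A K] [Field L] [Algebra K L]
    [Algebra A L] [IsScalarTower A K L] [Fintype ι] (b : Module.Basis ι K L) (x : L) :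
    ∃ d : A, d ≠ 0 ∧ d • x ∈ Submodule.span A (Set.range b) := by
  classical
  obtain ⟨d, hd⟩ := IsLocalization.exist_integer_multiples_of_finset (nonZeroDivisors A)
    (Finset.univ.image fun i => b.repr x i)
  refine ⟨d, nonZeroDivisors.ne_zero d.2, (Submodule.mem_span_range_iff_exists_fun A).2 ?_⟩
  choose v hv using fun i => hd (b.repr x i)
    (Finset.mem_image_of_mem _ (Finset.mem_univ i))
  refine ⟨v, ?_⟩
  conv_rhs => rw [← b.sum_repr x, Finset.smul_sum]
  refine Finset.sum_congr rfl fun i _ => ?_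
  rw [← smul_assoc, ← hv i, algebraMap_smul]

-- The coordinate functionals of `b` reduce the claim to injectivity of `R^ → K ⊗ R^`, which is
-- flatness of the completion `R^`.
open IsLocalRing in
theorem eq_zero_of_forall_tmul_sum_eq_zero (b : Module.Basis ι K L)
    (r : ι → AdicCompletion (maximalIdeal R) R)
    (h : ∑ i, (b i) ⊗ₜ[R] r i = 0) (i : ι) : r i = 0 := by
  have := AdicCompletion.flat_of_isNoetherian (maximalIdeal R)
  have h1 := congrArg (LinearMap.rTensor (AdicCompletion (maximalIdeal R) R)
    ((b.coord i).restrictScalars R)) h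
  classical
  simp only [map_sum, LinearMap.rTensor_tmul, LinearMap.coe_restrictScalars,
    Module.Basis.coord_apply, Module.Basis.repr_self, map_zero, Finsupp.single_apply] at h1
  rw [Finset.sum_eq_single i (fun j _ hj => by rw [if_neg hj, zero_tmul])
    (fun h => absurd (Finset.mem_univ _) h), if_pos rfl] at h1
  have hinj := Module.Flat.rTensor_preserves_injective_linearMap
    (M := AdicCompletion (maximalIdeal R) R) (Algebra.linearMap R K) (IsFractionRing.injective R K)
  have h2 : (1 : R) ⊗ₜ[R] r i = 0 := by
    apply hinj
    simpa using h1
  simpa using congrArg (TensorProduct.lid R _) h2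

-- If no power of the uniformizer bounded the denominators, there would be combinations of the `b i`
-- increasingly divisible in the integral closure but with coefficients not all divisible by `t`. A
-- limit of these in the completion is a nonzero element of `L ⊗ R^` whose `q`-th power vanishes,
-- contrary to reducedness.
open IsLocalRing in
theorem exists_smul_mem_span_of_isReduced {p n : ℕ} [ExpChar L p]
    (hq : ∀ x : L, x ^ p ^ n ∈ (algebraMap K L).range)
    [hred : IsReduced (L ⊗[R] AdicCompletion (maximalIdeal R) R)]
    (b : Module.Basis ι K L) (hb : ∀ i, IsIntegral R (b i)) :
    ∃ d : R, d ≠ 0 ∧ ∀ x : L, IsIntegral R x → d • x ∈ Submodule.span R (Set.range b) := by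
  classical
  set q := p ^ n with hqdef
  have hq0 : q ≠ 0 := (pow_pos (expChar_pos L p) n).ne'
  have hRL : Function.Injective (algebraMap R L) := by
    rw [IsScalarTower.algebraMap_eq R K L]
    exact (algebraMap K L).injective.comp (IsFractionRing.injective R K)
  choose β hβ using fun i => exists_algebraMap_pow_eq hq (hb i)
  -- The `q`-th power of `∑ v i • b i`, viewed in `R`. It is additive because `q` is a power of the
  -- exponential characteristic.
  let ν : (ι → R) → R := fun v => ∑ i, v i ^ q * β i
  have hν (v : ι → R) : algebraMap R L (ν v) = (∑ i, v i • b i) ^ q := by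
    rw [hqdef, sum_pow_char_pow, map_sum]
    refine Finset.sum_congr rfl fun i _ => ?_
    rw [Algebra.smul_def, mul_pow, map_mul, map_pow, hβ]
  have hν_add (v w : ι → R) : ν (v + w) = ν v + ν w := by
    apply hRL
    rw [map_add, hν, hν, hν, hqdef, ← add_pow_expChar_pow, ← Finset.sum_add_distrib]
    simp [add_smul]
  have hν_smul (c : R) (v : ι → R) : ν (c • v) = c ^ q * ν v := by
    simp only [ν, Finset.mul_sum, Pi.smul_apply, smul_eq_mul, mul_pow, mul_assoc]
  obtain ⟨t, ht⟩ := IsDiscreteValuationRing.exists_irreducible R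
  -- Membership in `I N` means that `∑ v i • b i` is `t ^ N` times an integral element, since
  -- integrality can be tested on `q`-th powers.
  let I : ℕ → Submodule R (ι → R) := fun N =>
    { carrier := {v | t ^ (q * N) ∣ ν v}
      add_mem' := fun {v w} hv hw => by
        rw [Set.mem_ofPred_eq] at hv hw ⊢
        rw [hν_add]; exact dvd_add hv hw
      zero_mem' := by simp [ν, hq0]
      smul_mem' := fun c v hv => by
        rw [Set.mem_ofPred_eq] at hv ⊢
        rw [hν_smul]; exact hv.mul_left _ }
  let T : ℕ → Submodule R (ι → R) := fun j =>
    { carrier := {v | ∀ i, t ^ j ∣ v i}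
      add_mem' := fun {v w} hv hw i => dvd_add (hv i) (hw i)
      zero_mem' := fun i => dvd_zero _
      smul_mem' := fun c v hv i => (hv i).mul_left _ }
  have hI : Antitone I := fun a c h v hv => (pow_dvd_pow t (Nat.mul_le_mul_left q h)).trans hv
  have hT : Antitone T := fun a c h v hv i => (pow_dvd_pow t h).trans (hv i)
  -- In the first case `t ^ N` is a common denominator; in the second the lemma on decreasing
  -- submodules applies with `k = 1`.
  by_cases hN : ∃ N, I N ≤ T 1
  · obtain ⟨N, hN⟩ := hN
    refine ⟨t ^ N, pow_ne_zero _ ht.ne_zero, fun x hx => ?_⟩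
    have hmem (y : L) : y ∈ Submodule.span R (Set.range b) ↔ ∃ v : ι → R, ∑ i, v i • b i = y :=
      Submodule.mem_span_range_iff_exists_fun R
    -- For integral `x`, the coefficients of `t ^ (N + j + 1) • x` form a vector of `I (N + j + 1) ≤
    -- I N ≤ T 1`, so one factor `t` cancels.
    have hdesc (j : ℕ) : t ^ (N + j) • x ∈ Submodule.span R (Set.range b) →
        t ^ N • x ∈ Submodule.span R (Set.range b) := by
      induction j with
      | zero => exact id
      | succ j ih =>
        intro h
        apply ih
        obtain ⟨v, hv⟩ := (hmem _).1 h
        obtain ⟨r, hr⟩ := exists_algebraMap_pow_eq hq hx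
        have hvI : v ∈ I (N + (j + 1)) := by
          refine ⟨r, hRL ?_⟩
          rw [hν, hv, Algebra.smul_def, mul_pow, map_mul, hr, map_pow, map_pow]
          ring
        choose w hw using hN (hI (Nat.le_add_right _ _) hvI)
        refine (hmem _).2 ⟨w, ?_⟩
        have ht' : algebraMap R L t ≠ 0 := by
          rw [Ne, map_eq_zero_iff _ hRL]; exact ht.ne_zero
        apply mul_left_cancel₀ ht'
        rw [← Algebra.smul_def, ← Algebra.smul_def, smul_smul, ← pow_succ', add_assoc, ← hv,
          Finset.smul_sum]
        refine Finset.sum_congr rfl fun i _ => ?_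
        rw [hw i, smul_smul, pow_one]
    obtain ⟨d, hd0, hdx⟩ := exists_smul_mem_span (A := R) b x
    obtain ⟨m, u, hu⟩ := IsDiscreteValuationRing.eq_unit_mul_pow_irreducible hd0 ht
    have htx : t ^ m • x ∈ Submodule.span R (Set.range b) := by
      have := Submodule.smul_mem _ ((u⁻¹ : Rˣ) : R) hdx
      rwa [hu, smul_smul, Units.inv_mul_cancel_left] at this
    refine hdesc m ?_
    rw [pow_add, mul_smul]
    exact Submodule.smul_mem _ _ htx
  · push Not at hN
    exfalso
    have hmax : maximalIdeal R = Ideal.span {t} :=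
      (IsDiscreteValuationRing.irreducible_iff_uniformizer t).1 ht
    have hart (j : ℕ) : IsArtinian R ((ι → R) ⧸ T j) := by
      have h1 : IsArtinian R (R ⧸ Ideal.span {t ^ j}) :=
        (isFiniteLength_iff_isNoetherian_isArtinian.mp (isFiniteLength_quotient_span_singleton R
          (mem_nonZeroDivisors_of_ne_zero (pow_ne_zero _ ht.ne_zero)))).2
      let φ : (ι → R) →ₗ[R] (ι → R ⧸ Ideal.span {t ^ j}) :=
        LinearMap.pi fun i => (Submodule.mkQ (Ideal.span {t ^ j})).comp (LinearMap.proj i)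
      have hφ : φ.ker = T j := by
        ext v
        simp only [φ, T, LinearMap.mem_ker, funext_iff, LinearMap.pi_apply, LinearMap.comp_apply,
          LinearMap.proj_apply, Submodule.mkQ_apply, Submodule.Quotient.mk_eq_zero,
          Ideal.mem_span_singleton, Pi.zero_apply]
        rfl
      rw [← hφ]
      exact isArtinian_of_injective (φ.ker.liftQ φ le_rfl)
        (LinearMap.ker_eq_bot.mp (Submodule.ker_liftQ_eq_bot _ _ _ le_rfl))
    obtain ⟨y, hy0, hyT, hyI⟩ := Submodule.exists_seq_of_antitone hI hT hart hN
    have hpow (n : ℕ) : (maximalIdeal R ^ n • ⊤ : Submodule R R) = Ideal.span {t ^ n} := by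
      rw [smul_eq_mul, Ideal.mul_top, hmax, Ideal.span_singleton_pow]
    let r : ι → AdicCompletion (maximalIdeal R) R := fun i =>
      AdicCompletion.mk _ _ (AdicCompletion.AdicCauchySequence.mk (maximalIdeal R) R
        (fun n => y n i) fun n => by
          rw [SModEq.sub_mem, hpow, Ideal.mem_span_singleton, ← neg_sub, dvd_neg]
          exact (pow_dvd_pow t (Nat.le_add_left n 1)).trans (hyT n i))
    have hrn (i : ι) (n : ℕ) : AdicCompletion.evalₐ (maximalIdeal R) n (r i) =
        Ideal.Quotient.mk _ (y n i) := AdicCompletion.evalₐ_mk _ _ _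
    -- The limit has the class of `y 1` modulo `t`, which is that of `y 0` and is nonzero.
    have hr0 : ∃ i, r i ≠ 0 := by
      by_contra! h
      refine hy0 fun i => ?_
      have h1 := hrn i 1
      rw [h, map_zero, eq_comm, Ideal.Quotient.eq_zero_iff_mem, pow_one, hmax,
        Ideal.mem_span_singleton] at h1
      have h2 := hyT 0 i
      rw [pow_one]
      simpa using dvd_sub h1 ((pow_one t ▸ h2 : t ∣ (y 1 - y 0) i))
    -- Since `y n ∈ I n ⊔ T n`, additivity gives `t ^ n ∣ ν (y n)`, so the extension of `ν` to the
    -- completion kills the limit.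
    have hsum : ∑ i, r i ^ q * algebraMap R _ (β i) = 0 := by
      refine AdicCompletion.ext_evalₐ fun n => ?_
      have h1 : ∀ i, AdicCompletion.evalₐ (maximalIdeal R) n
          (algebraMap R _ (β i)) = Ideal.Quotient.mk _ (β i) := fun i => by
        rw [AlgHom.commutes]; rfl
      have h2 : ν (y n) ∈ maximalIdeal R ^ n := by
        rw [hmax, Ideal.span_singleton_pow, Ideal.mem_span_singleton]
        obtain ⟨u, hu, w, hw, huw⟩ := Submodule.mem_sup.mp (hyI n n)
        rw [← huw, hν_add]
        have hnq : n ≤ q * n := Nat.le_mul_of_pos_left n (Nat.pos_of_ne_zero hq0)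
        refine dvd_add ((pow_dvd_pow t hnq).trans hu) (Finset.dvd_sum fun i _ => ?_)
        exact ((hw i).trans (dvd_pow_self _ hq0)).mul_right _
      simp only [map_sum, map_mul, map_pow, hrn, h1, map_zero]
      rw [← Ideal.Quotient.eq_zero_iff_mem] at h2
      simpa only [ν, map_sum, map_mul, map_pow] using h2
    have hc : (∑ i, (b i) ⊗ₜ[R] r i) ^ q = 0 := by
      have hexp : ExpChar (L ⊗[R] AdicCompletion (maximalIdeal R) R) p := by
        have : Nontrivial (L ⊗[R] AdicCompletion (maximalIdeal R) R) := by
          obtain ⟨i, hi⟩ := hr0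
          refine ⟨_, 0, fun h => hi (eq_zero_of_forall_tmul_sum_eq_zero b r h i)⟩
        exact expChar_of_injective_algebraMap (algebraMap L _).injective p
      rw [hqdef, sum_pow_char_pow, ← hqdef]
      simp only [Algebra.TensorProduct.tmul_pow, ← hβ]
      rw [← TensorProduct.tmul_zero (R := R) _ (1 : L), ← hsum, TensorProduct.tmul_sum]
      refine Finset.sum_congr rfl fun i _ => ?_
      rw [Algebra.algebraMap_eq_smul_one, TensorProduct.smul_tmul, mul_comm, Algebra.smul_def]
    obtain ⟨i, hi⟩ := hr0
    exact hi (eq_zero_of_forall_tmul_sum_eq_zero b r (pow_eq_zero_iff hq0 |>.1 hc) i)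

end DVR

/-! ### Reducedness of the formal fibres -/

section RegularFibre

variable {R K L : Type*} [CommRing R] [IsDomain R] [IsDiscreteValuationRing R]
  [Field K] [Algebra R K] [IsFractionRing R K] [Field L] [Algebra K L] [Algebra R L]
  [IsScalarTower R K L]

-- Choose a level `n` at which `r` does not vanish. There it agrees with `u * t ^ m` for a unit `u`
-- and some `m < n`; as the kernel of evaluation is generated by `t ^ n`, the quotient `r / t ^ m`
-- is `u` plus a multiple of `t ^ (n - m)`, hence a unit.
open IsLocalRing in
theorem AdicCompletion.eq_zero_or_eq_unit_mul_pow {t : R} (ht : Irreducible t)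
    (r : AdicCompletion (maximalIdeal R) R) :
    r = 0 ∨ ∃ (u : (AdicCompletion (maximalIdeal R) R)ˣ) (m : ℕ),
      r = u * algebraMap R _ (t ^ m) := by
  have hmax : maximalIdeal R = Ideal.span {t} :=
    (IsDiscreteValuationRing.irreducible_iff_uniformizer t).1 ht
  by_cases hr : r = 0
  · exact Or.inl hr
  obtain ⟨n, hn⟩ : ∃ n, AdicCompletion.evalₐ (maximalIdeal R) n r ≠ 0 := by
    by_contra! h
    exact hr (AdicCompletion.ext_evalₐ fun n => by rw [h, _root_.map_zero])
  obtain ⟨a, ha⟩ := Ideal.Quotient.mk_surjective (AdicCompletion.evalₐ (maximalIdeal R) n r)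
  have ha' : a ∉ maximalIdeal R ^ n := by
    rwa [← Ideal.Quotient.eq_zero_iff_mem, ha]
  have ha0 : a ≠ 0 := by rintro rfl; exact ha' (zero_mem _)
  obtain ⟨m, u, rfl⟩ := IsDiscreteValuationRing.eq_unit_mul_pow_irreducible ha0 ht
  have hmn : m < n := by
    by_contra! h
    refine ha' (Ideal.mul_mem_left _ _ ?_)
    rw [hmax, Ideal.span_singleton_pow, Ideal.mem_span_singleton]
    exact pow_dvd_pow t h
  have hsub : r - algebraMap R _ (u * t ^ m) ∈ (AdicCompletion.eval (maximalIdeal R) R n).ker := by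
    have hle : maximalIdeal R ^ n ≤ maximalIdeal R ^ n • ⊤ := by rw [smul_eq_mul, Ideal.mul_top]
    rw [LinearMap.mem_ker, ← AdicCompletion.factor_evalₐ_eq_eval _ _ hle, map_sub, ← ha,
      AlgHom.commutes, Ideal.Quotient.algebraMap_eq, sub_self, _root_.map_zero]
  rw [← AdicCompletion.pow_smul_top_eq_ker_eval (IsNoetherian.noetherian _)] at hsub
  have hsm (I : Ideal R) (hI : I = Ideal.span {t ^ n})
      (x : AdicCompletion (maximalIdeal R) R) (hx : x ∈ I • (⊤ : Submodule R _)) :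
      ∃ z, t ^ n • z = x := by
    rw [hI, Submodule.ideal_span_singleton_smul] at hx
    obtain ⟨z, -, hz⟩ := hx
    exact ⟨z, hz⟩
  obtain ⟨z, hz⟩ := hsm _ (by rw [hmax, Ideal.span_singleton_pow]) _ hsub
  have hmem : algebraMap R _ (t ^ (n - m)) * z ∈
      maximalIdeal (AdicCompletion (maximalIdeal R) R) := by
    refine Ideal.mul_mem_right _ _ ?_
    rw [AdicCompletion.maximalIdeal_eq_map]
    refine Ideal.mem_map_of_mem _ ?_
    rw [hmax, Ideal.mem_span_singleton]
    exact dvd_pow_self t (Nat.sub_ne_zero_of_lt hmn)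
  have hunit : IsUnit (algebraMap R (AdicCompletion (maximalIdeal R) R) u +
      algebraMap R _ (t ^ (n - m)) * z) := by
    by_contra h
    have h1 := Ideal.sub_mem _ ((mem_maximalIdeal _).2 h) hmem
    rw [add_sub_cancel_right] at h1
    exact h1 (u.isUnit.map _)
  refine Or.inr ⟨hunit.unit, m, ?_⟩
  rw [IsUnit.unit_spec, add_mul, mul_right_comm, ← map_mul, ← map_mul, ← pow_add,
    Nat.sub_add_cancel hmn.le]
  rw [Algebra.smul_def] at hz
  rw [hz]; ring

/-- Unless it is zero, such a ring is local of dimension zero, so regularity forces its maximal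
ideal to have no generators: it is a field. -/
theorem IsReduced.of_isRegularRing_of_isNilpotent_or_isUnit {C : Type*} [CommRing C]
    [IsRegularRing C] (h : ∀ c : C, IsNilpotent c ∨ IsUnit c) : IsReduced C := by
  rcases subsingleton_or_nontrivial C with hC | hC
  · infer_instance
  have hloc : IsLocalRing C := IsLocalRing.of_nonunits_add fun {a b} ha hb => by
    have h1 := (h a).resolve_right ha
    have h2 := (h b).resolve_right hb
    exact fun h3 => ((Commute.all a b).isNilpotent_add h1 h2).not_isUnit h3
  have hreg := IsRegularLocalRing.of_isRegularRing_of_isLocalRing C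
  have hdim : Ring.KrullDimLE 0 C := Ring.KrullDimLE.mk₀ fun I hI => by
    rw [Ideal.isMaximal_iff]
    refine ⟨fun h1 => hI.ne_top ((Ideal.eq_top_iff_one _).2 h1), fun J x hIJ hx hxJ => ?_⟩
    rcases h x with h1 | h1
    · exact absurd (nilpotent_iff_mem_prime.1 h1 I hI) hx
    · exact (Ideal.eq_top_iff_one _).1 (Ideal.eq_top_of_isUnit_mem _ hxJ h1)
  have h0 : (IsLocalRing.maximalIdeal C).spanFinrank = 0 := by
    have := hreg.spanFinrank_maximalIdeal
    rw [ringKrullDimZero_iff_ringKrullDim_eq_zero.1 hdim] at this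
    exact_mod_cast this
  rw [Submodule.spanFinrank_eq_zero_iff_eq_bot (IsNoetherian.noetherian _)] at h0
  refine ⟨fun x hx => ?_⟩
  have : x ∈ IsLocalRing.maximalIdeal C := fun hu => hx.not_isUnit hu
  rwa [h0] at this

-- Up to a power of `t`, which is invertible in `L`, the `q`-th power of any element of `L ⊗ R^`
-- comes from `R^`. There it is zero or a unit times a power of `t`, so the element itself is
-- nilpotent or a unit.
open IsLocalRing in
theorem isReduced_tensorProduct_adicCompletion {p n : ℕ} [ExpChar L p]
    (hq : ∀ x : L, x ^ p ^ n ∈ (algebraMap K L).range)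
    [IsRegularRing (L ⊗[R] AdicCompletion (maximalIdeal R) R)] :
    IsReduced (L ⊗[R] AdicCompletion (maximalIdeal R) R) := by
  rcases subsingleton_or_nontrivial (L ⊗[R] AdicCompletion (maximalIdeal R) R) with hC | hC
  · infer_instance
  obtain ⟨t, ht⟩ := IsDiscreteValuationRing.exists_irreducible R
  have hexp : ExpChar (L ⊗[R] AdicCompletion (maximalIdeal R) R) p :=
    expChar_of_injective_algebraMap (algebraMap L _).injective p
  have htL : algebraMap R L t ≠ 0 := by
    rw [IsScalarTower.algebraMap_apply R K L, Ne, map_eq_zero,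
      map_eq_zero_iff _ (IsFractionRing.injective R K)]
    exact ht.ne_zero
  have htu : IsUnit (algebraMap R (L ⊗[R] AdicCompletion (maximalIdeal R) R) t) := by
    rw [IsScalarTower.algebraMap_apply R L]
    exact (isUnit_iff_ne_zero.2 htL).map _
  have key (c : L ⊗[R] AdicCompletion (maximalIdeal R) R) :
      ∃ (m : ℕ) (s : AdicCompletion (maximalIdeal R) R), t ^ m • c ^ p ^ n = 1 ⊗ₜ s := by
    induction c with
    | zero => 
      refine ⟨0, 0, ?_⟩
      rw [zero_pow (pow_pos (expChar_pos L p) n).ne', smul_zero, tmul_zero]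
    | tmul l r =>
      obtain ⟨k, hk⟩ := hq l
      obtain ⟨a, b, hb, rfl⟩ := IsFractionRing.div_surjective (A := R) k
      obtain ⟨m, u, hu⟩ := IsDiscreteValuationRing.eq_unit_mul_pow_irreducible
        (nonZeroDivisors.ne_zero hb) ht
      refine ⟨m, ((u⁻¹ : Rˣ) * a : R) • r ^ p ^ n, ?_⟩
      rw [Algebra.TensorProduct.tmul_pow, ← hk, TensorProduct.tmul_smul, TensorProduct.smul_tmul',
        TensorProduct.smul_tmul']
      congr 1
      have hb' : algebraMap R K b ≠ 0 := by
        simpa using nonZeroDivisors.ne_zero hb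
      have hL : algebraMap R L = (algebraMap K L).comp (algebraMap R K) :=
        IsScalarTower.algebraMap_eq R K L
      rw [Algebra.smul_def, Algebra.smul_def, mul_one, hL, RingHom.comp_apply, RingHom.comp_apply,
        ← map_mul, ← mul_div_assoc, ← map_mul]
      congr 1
      rw [div_eq_iff hb', ← map_mul, hu]
      congr 1
      linear_combination -(a * t ^ m) * u.inv_mul
    | add x y hx hy =>
      obtain ⟨m, s, h⟩ := hx
      obtain ⟨m', s', h'⟩ := hy
      refine ⟨m + m', t ^ m' • s + t ^ m • s', ?_⟩
      rw [add_pow_expChar_pow, smul_add, pow_add, mul_smul, mul_smul, h', smul_comm, h,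
        TensorProduct.tmul_add, TensorProduct.tmul_smul, TensorProduct.tmul_smul]
  refine IsReduced.of_isRegularRing_of_isNilpotent_or_isUnit fun c => ?_
  obtain ⟨m, s, h⟩ := key c
  have hsmul (z : R) (x : L ⊗[R] AdicCompletion (maximalIdeal R) R) :
      z • x = algebraMap R _ z * x := Algebra.smul_def z x
  rw [hsmul, map_pow] at h
  have hu : IsUnit (algebraMap R (L ⊗[R] AdicCompletion (maximalIdeal R) R) t ^ m) := htu.pow m
  have hq0 : p ^ n ≠ 0 := (pow_pos (expChar_pos L p) n).ne'
  rcases AdicCompletion.eq_zero_or_eq_unit_mul_pow ht s with rfl | ⟨u, j, rfl⟩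
  · rw [tmul_zero, hu.mul_right_eq_zero] at h
    exact Or.inl ⟨_, h⟩
  · right
    rw [← isUnit_pow_iff hq0]
    refine isUnit_of_mul_isUnit_right (x := algebraMap R _ t ^ m) ?_
    rw [h, mul_comm, ← Algebra.smul_def, TensorProduct.tmul_smul, hsmul, map_pow]
    exact (htu.pow j).mul (u.isUnit.map (Algebra.TensorProduct.includeRight : _ →ₐ[R] L ⊗[R] _))

end RegularFibre

/-! ### Heights in integral extensions of normal domains -/

/-- Going down over a normal domain gives one inequality, incomparability of primes in a fibre the
other. -/
theorem Ideal.height_under_eq_of_isIntegral {A B : Type*} [CommRing A] [CommRing B] [IsNoetherianRing A]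
    [IsDomain B]
    [IsNoetherianRing B] [Algebra A B] [FaithfulSMul A B] [Algebra.IsIntegral A B]
    [IsIntegrallyClosed A] (P : Ideal B) [P.IsPrime] : (P.under A).height = P.height := by
  apply le_antisymm
  · rw [Ideal.height_eq_height_add_of_liesOver_of_hasGoingDown (P.under A) P]
    exact le_self_add
  · have hmono : StrictMono (PrimeSpectrum.comap (algebraMap A B)) := fun I J h =>
      Ideal.IsIntegral.comap_lt_comap h
    have := Order.height_le_height_apply_of_strictMono _ hmono ⟨P, inferInstance⟩
    rwa [← PrimeSpectrum.height_eq_orderHeight, ← PrimeSpectrum.height_eq_orderHeight] at this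

/-- A regular local domain of dimension at most one is integrally closed. -/
theorem IsRegularLocalRing.isIntegrallyClosed_of_ringKrullDim_le_one (R : Type*) [CommRing R]
    [IsDomain R] [IsRegularLocalRing R] (h : ringKrullDim R ≤ 1) : IsIntegrallyClosed R := by
  have hfg : (IsLocalRing.maximalIdeal R).FG := IsNoetherian.noetherian _
  have h1 : (IsLocalRing.maximalIdeal R).spanFinrank ≤ 1 := by
    have := IsRegularLocalRing.spanFinrank_maximalIdeal (R := R)
    rw [← this] at h
    exact_mod_cast h
  have h2 : (IsLocalRing.maximalIdeal R).IsPrincipal := by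
    rw [← Submodule.FG.generators_ncard hfg, Set.ncard_le_one_iff_eq
      (Submodule.FG.finite_generators hfg)] at h1
    have hspan := (IsLocalRing.maximalIdeal R).span_generators
    rcases h1 with h1 | ⟨a, h1⟩
    · rw [h1, Submodule.span_empty] at hspan
      rw [← hspan]; infer_instance
    · rw [h1] at hspan
      exact ⟨a, hspan.symm⟩
  have h3 : IsPrincipalIdealRing R :=
    ((tfae_of_isNoetherianRing_of_isLocalRing_of_isDomain R).out 4 0).1 h2
  infer_instance

/-! ### Generic normality of finite extensions of J-2 domains -/

section Generic

variable {A K L ι : Type u} [CommRing A] [IsDomain A] [IsNoetherianRing A] [IsIntegrallyClosed A]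
  [Field K] [Algebra A K] [IsFractionRing A K] [Field L] [Algebra K L] [Algebra A L]
  [IsScalarTower A K L] [Fintype ι]

omit [IsNoetherianRing A] [IsIntegrallyClosed A] in
theorem isFractionRing_adjoin_range_basis (b : Module.Basis ι K L) :
    IsFractionRing (Algebra.adjoin A (Set.range b)) L := by
  refine IsFractionRing.of_field _ L fun z => ?_
  obtain ⟨d, hd, hdz⟩ := exists_smul_mem_span (A := A) b z
  refine ⟨⟨d • z, Algebra.span_le_adjoin A _ hdz⟩, algebraMap A _ d, ?_⟩
  have hd' : algebraMap A L d ≠ 0 := by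
    rw [IsScalarTower.algebraMap_apply A K L, Ne, map_eq_zero,
      map_eq_zero_iff _ (IsFractionRing.injective A K)]
    exact hd
  change z = d • z / algebraMap A L d
  rw [Algebra.smul_def, mul_div_cancel_left₀ _ hd']

/-- The ring `B` generated by the basis is finite over `A` with fraction field `L`. Its regular
locus is open and contains the generic point, hence contains some `D(f)`, and `a = f ^ q` lies in
`A`. If `a ∉ p`, a prime `P` of `B` over `p` avoids `f` and has height one, so `B_P` is integrally
closed and contains every integral `x`. -/
theorem exists_smul_mem_adjoin_of_isJTwo (hJ : PlusRegular.IsJTwo A) {q : ℕ} (hq0 : q ≠ 0)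
    (hq : ∀ x : L, x ^ q ∈ (algebraMap K L).range)
    (b : Module.Basis ι K L) (hb : ∀ i, IsIntegral A (b i)) :
    ∃ a : A, a ≠ 0 ∧ ∀ p : Ideal A, p.IsPrime → p.height = 1 → a ∉ p → ∀ x : L, IsIntegral A x →
      ∃ s ∉ p, s • x ∈ Algebra.adjoin A (Set.range b) := by
  set B := Algebra.adjoin A (Set.range b)
  have hAL : Function.Injective (algebraMap A L) := by
    rw [IsScalarTower.algebraMap_eq A K L]
    exact (algebraMap K L).injective.comp (IsFractionRing.injective A K)
  have hfaith : FaithfulSMul A B := (faithfulSMul_iff_algebraMap_injective A B).2 fun x y h =>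
    hAL (congrArg Subtype.val h)
  have hint : Algebra.IsIntegral A B := Algebra.IsIntegral.adjoin (by rintro _ ⟨i, rfl⟩; exact hb i)
  have hft : Algebra.FiniteType A B :=
    (Subalgebra.fg_iff_finiteType _).1 (Subalgebra.fg_def.2 ⟨_, Set.finite_range b, rfl⟩)
  have hfin : Module.Finite A B := Algebra.IsIntegral.finite
  have hnoeth : IsNoetherianRing B := IsNoetherianRing.of_finite A B
  have hfrac : IsFractionRing B L := isFractionRing_adjoin_range_basis b
  have hpow (x : B) : ∃ a : A, algebraMap A B a = x ^ q := by
    obtain ⟨a, ha⟩ := exists_algebraMap_pow_eq hq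
      (hx := (Algebra.IsIntegral.isIntegral (R := A) x).algebraMap (B := L))
    exact ⟨a, Subtype.ext ha⟩
  have hbot : (⟨⊥, Ideal.isPrime_bot⟩ : PrimeSpectrum B) ∈
      {P : PrimeSpectrum B | IsRegularLocalRing (Localization.AtPrime P.asIdeal)} := by
    let : Field (Localization.AtPrime (⊥ : Ideal B)) := IsField.toField <| by
      simp [IsLocalRing.isField_iff_maximalIdeal_eq, ← Localization.AtPrime.map_eq_maximalIdeal]
    change IsRegularLocalRing (Localization.AtPrime (⊥ : Ideal B))
    infer_instance
  obtain ⟨_, ⟨f, rfl⟩, hf, hfU⟩ := PrimeSpectrum.isTopologicalBasis_basic_opens.exists_subset_of_mem_open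
    hbot (hJ B)
  obtain ⟨a, ha⟩ := hpow f
  have hf0 : f ≠ 0 := hf
  refine ⟨a, ?_, fun p hp hp1 hap x hx => ?_⟩
  · rintro rfl
    rw [map_zero] at ha
    exact hf0 (pow_eq_zero_iff hq0 |>.1 ha.symm)
  obtain ⟨P, hP, hPp⟩ := Ideal.exists_ideal_over_prime_of_isIntegral_of_isDomain (S := B) p
    (by rw [(RingHom.injective_iff_ker_eq_bot _).1 (FaithfulSMul.algebraMap_injective A B)]
        exact bot_le)
  have hPu : P.under A = p := hPp
  have hfP : f ∉ P := fun h => hap <| by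
    rw [← hPu, Ideal.mem_comap, ha]
    exact P.pow_mem_of_mem h q (Nat.pos_of_ne_zero hq0)
  have hreg : IsRegularLocalRing (Localization.AtPrime P) := hfU (a := ⟨P, hP⟩) hfP
  have hclosed : IsIntegrallyClosed (Localization.AtPrime P) := by
    apply IsRegularLocalRing.isIntegrallyClosed_of_ringKrullDim_le_one
    rw [IsLocalization.AtPrime.ringKrullDim_eq_height P, ← P.height_under_eq_of_isIntegral (A := A),
      hPu, hp1]
    rfl
  let D := Localization.subalgebra.ofField L P.primeCompl P.primeCompl_le_nonZeroDivisors
  have hDloc : IsLocalization.AtPrime D P := Localization.subalgebra.isLocalization_ofField L _ _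
  have hDfrac : IsFractionRing D L := Localization.subalgebra.isFractionRing_ofField L _ _
  have hD : IsIntegrallyClosed D := .of_equiv
    (IsLocalization.algEquiv P.primeCompl (Localization.AtPrime P) D).toRingEquiv
  obtain ⟨y, rfl⟩ := IsIntegrallyClosed.isIntegral_iff.mp
    (IsIntegral.tower_top (R := B) (A := D) (IsIntegral.tower_top (R := A) (A := B) hx))
  obtain ⟨c, s, hs, hcs⟩ := y.2
  -- The denominator of `x` lies in `B` outside `P`; its `q`-th power is a denominator in `A`
  -- outside `p`.
  obtain ⟨s', hs'⟩ := hpow s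
  refine ⟨s', fun h => hs ?_, ?_⟩
  · rw [← hPu, Ideal.mem_comap, hs'] at h
    exact hP.mem_of_pow_mem _ h
  · have hs0 : algebraMap B L s ≠ 0 := by
      rw [Ne, map_eq_zero_iff _ (IsFractionRing.injective B L)]
      rintro rfl
      exact hs P.zero_mem
    have h1 : s' • algebraMap D L y = ((s ^ (q - 1) * c : B) : L) := by
      have h2 : algebraMap A L s' = (s : L) ^ q := congrArg Subtype.val hs'
      have h3 : algebraMap D L y = (c : L) * (s : L)⁻¹ := hcs
      have h4 : (s : L) ≠ 0 := hs0
      rw [Algebra.smul_def, h2, h3, Subalgebra.coe_mul, Subalgebra.coe_pow,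
        ← pow_sub_one_mul hq0]
      field_simp
    rw [h1]
    exact Subtype.property _

end Generic

/-! ### Finiteness of integral closure: the purely inseparable case -/

section Insep

/-- Over a local domain with geometrically regular formal fibres, the completed finite extensions
of the fraction field are regular. -/
theorem PlusRegular.HasGeometricallyRegularFormalFibres.isRegularRing_tensorProduct
    {R K L : Type u} [CommRing R] [IsDomain R] [IsLocalRing R]
    (hR : PlusRegular.HasGeometricallyRegularFormalFibres R)
    [Field K] [Algebra R K] [IsFractionRing R K] [Field L] [Algebra K L] [Algebra R L]
    [IsScalarTower R K L] [FiniteDimensional K L] :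
    IsRegularRing (L ⊗[R] AdicCompletion (IsLocalRing.maximalIdeal R) R) := by
  let κ := (⊥ : Ideal R).ResidueField
  have hRK := IsFractionRing.injective R K
  let φ : κ →ₐ[R] K := Ideal.ResidueField.liftₐ (⊥ : Ideal R) (Algebra.ofId R K) bot_le
    (fun x hx => by
      refine isUnit_iff_ne_zero.2 ?_
      rw [Algebra.ofId_apply, Ne, map_eq_zero_iff _ hRK]
      exact hx)
  let : Algebra κ K := φ.toRingHom.toAlgebra
  let : Algebra κ L := ((algebraMap K L).comp φ.toRingHom).toAlgebra
  have : IsScalarTower κ K L := .of_algebraMap_eq' rfl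
  have : IsScalarTower R κ L := .of_algebraMap_eq fun x => by
    rw [IsScalarTower.algebraMap_apply R K L]
    exact congrArg (algebraMap K L) (φ.commutes x).symm
  -- The residue field at the zero ideal is identified with `K`, so `L` is one of the finite
  -- extensions allowed in the definition.
  have hsurj : Function.Surjective (Algebra.linearMap κ K) := fun z => by
    obtain ⟨a, b, hb, rfl⟩ := IsFractionRing.div_surjective (A := R) z
    refine ⟨algebraMap R κ a / algebraMap R κ b, ?_⟩
    rw [Algebra.linearMap_apply, map_div₀]
    exact congrArg₂ (· / ·) (φ.commutes a) (φ.commutes b)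
  have : Module.Finite κ K := Module.Finite.of_surjective _ hsurj
  have : FiniteDimensional κ L := Module.Finite.trans K L
  exact hR ⊥ L

variable {A K L ι : Type u} [CommRing A] [IsDomain A] [IsNoetherianRing A] [IsIntegrallyClosed A]
  [Field K] [Algebra A K] [IsFractionRing A K] [Field L] [Algebra K L] [Algebra A L]
  [IsScalarTower A K L] [Fintype ι]

theorem isDiscreteValuationRing_localization_of_height_eq_one {p : Ideal A} [hp : p.IsPrime]
    (h : p.height = 1) : IsDiscreteValuationRing (Localization.AtPrime p) := by
  have h1 : ringKrullDim (Localization.AtPrime p) = 1 := by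
    rw [IsLocalization.AtPrime.ringKrullDim_eq_height p, h]; rfl
  have hf : ¬ IsField (Localization.AtPrime p) := fun hf => by
    rw [ringKrullDim_eq_zero_of_isField hf] at h1
    exact zero_ne_one h1
  have : IsIntegrallyClosed (Localization.AtPrime p) :=
    isIntegrallyClosed_of_isLocalization _ p.primeCompl p.primeCompl_le_nonZeroDivisors
  have : Ring.KrullDimLE 1 (Localization.AtPrime p) := by
    rw [Ring.krullDimLE_iff, h1]; rfl
  have hd : IsDedekindDomain (Localization.AtPrime p) := by
    have : Ring.DimensionLEOne (Localization.AtPrime p) :=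
      ⟨fun {p} h0 hp => (Ring.krullDimLE_one_iff_of_noZeroDivisors.mp this p h0 hp)⟩
    exact { }
  exact ((IsDiscreteValuationRing.TFAE _ hf).out 2 0).mp hd

/-- The discrete valuation ring `A_p` has a common denominator `d` for the integral closure. Its
numerator `c` is `d` times a unit of `A_p`, so it serves as well and lies in `A`. -/
theorem exists_smul_repr_mem_range_of_height_eq_one {ℓ n : ℕ} [ExpChar L ℓ]
    (hq : ∀ x : L, x ^ ℓ ^ n ∈ (algebraMap K L).range)
    (b : Module.Basis ι K L) (hb : ∀ i, IsIntegral A (b i)) {p : Ideal A} [hp : p.IsPrime]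
    (hp1 : p.height = 1)
    (hG : PlusRegular.HasGeometricallyRegularFormalFibres (Localization.AtPrime p)) :
    ∃ c : A, c ≠ 0 ∧ ∀ x : L, IsIntegral A x → ∀ i, ∃ s ∉ p, ∃ a : A,
      s • b.repr (c • x) i = algebraMap A K a := by
  let R := Localization.AtPrime p
  have hdvr : IsDiscreteValuationRing R := isDiscreteValuationRing_localization_of_height_eq_one hp1
  let : Algebra R K := (IsLocalization.lift (M := p.primeCompl) (S := R) (g := algebraMap A K)
    fun y => isUnit_iff_ne_zero.2 (by
      rw [Ne, map_eq_zero_iff _ (IsFractionRing.injective A K)]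
      rintro h0
      exact y.2 (h0 ▸ p.zero_mem))).toAlgebra
  have : IsScalarTower A R K := .of_algebraMap_eq fun x => (IsLocalization.lift_eq _ x).symm
  have : IsFractionRing R K := IsFractionRing.isFractionRing_of_isDomain_of_isLocalization
    p.primeCompl R K
  let : Algebra R L := ((algebraMap K L).comp (algebraMap R K)).toAlgebra
  have : IsScalarTower R K L := .of_algebraMap_eq' rfl
  have : IsScalarTower A R L := .of_algebraMap_eq fun x => by
    rw [IsScalarTower.algebraMap_apply A K L, IsScalarTower.algebraMap_apply A R K]
    rfl
  have : FiniteDimensional K L := Module.Basis.finiteDimensional_of_finite b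
  have : IsRegularRing (L ⊗[R] AdicCompletion (IsLocalRing.maximalIdeal R) R) :=
    hG.isRegularRing_tensorProduct (K := K) (L := L)
  have := isReduced_tensorProduct_adicCompletion (R := R) (K := K) hq
  obtain ⟨d, hd, hspan⟩ := exists_smul_mem_span_of_isReduced (R := R) hq b
    fun i => (hb i).tower_top
  obtain ⟨c, t, hct⟩ := IsLocalization.exists_mk'_eq p.primeCompl d
  have hcd : algebraMap A R c = algebraMap A R t * d := by
    rw [← hct, IsLocalization.mk'_spec']
  refine ⟨c, ?_, fun x hx i => ?_⟩
  · rintro rfl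
    rw [map_zero, eq_comm, mul_eq_zero] at hcd
    refine hcd.elim (fun h => ?_) hd
    rw [map_eq_zero_iff _ (IsLocalization.injective R p.primeCompl_le_nonZeroDivisors)] at h
    exact t.2 (h ▸ p.zero_mem)
  · obtain ⟨v, hv⟩ := (Submodule.mem_span_range_iff_exists_fun R).1 (hspan x hx.tower_top)
    have h1 : c • x = ∑ i, algebraMap R K (algebraMap A R t * v i) • b i := by
      rw [← algebraMap_smul R c x, hcd, mul_smul, ← hv, Finset.smul_sum]
      refine Finset.sum_congr rfl fun i _ => ?_
      rw [algebraMap_smul K (algebraMap A R t * v i) (b i), mul_smul,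
        algebraMap_smul R t.1 (v i • b i)]
    have h2 : b.repr (c • x) i = algebraMap R K (algebraMap A R t * v i) := by
      rw [h1, b.repr_sum_self]
    obtain ⟨a, s, has⟩ := IsLocalization.exists_mk'_eq p.primeCompl (algebraMap A R t * v i)
    refine ⟨s, s.2, a, ?_⟩
    rw [h2, IsScalarTower.algebraMap_apply A R K, ← IsLocalization.mk'_spec' R a s, has,
      map_mul (algebraMap R K) (algebraMap A R s), ← IsScalarTower.algebraMap_apply,
      Algebra.smul_def]

/-- Coordinates lie in `A` once they do at every height one prime. One factor `d₀` serves the primes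
avoiding the element `a` of the generic statement; only finitely many height one primes contain `a`,
and each contributes its own factor. -/
theorem exists_smul_mem_span_of_isExcellentRing (hA : PlusRegular.IsExcellentRing A)
    {ℓ n : ℕ} [ExpChar L ℓ]
    (hq : ∀ x : L, x ^ ℓ ^ n ∈ (algebraMap K L).range)
    (b : Module.Basis ι K L) (hb : ∀ i, IsIntegral A (b i)) :
    ∃ d : A, d ≠ 0 ∧ ∀ x : L, IsIntegral A x → d • x ∈ Submodule.span A (Set.range b) := by
  classical
  obtain ⟨a, ha0, ha⟩ := exists_smul_mem_adjoin_of_isJTwo hA.isJTwo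
    (pow_pos (expChar_pos L ℓ) n).ne' hq b hb
  -- The subalgebra generated by the integral basis is a finite module, so the denominators of
  -- finitely many generators multiply to a common one.
  obtain ⟨d₀, hd₀, hspan⟩ : ∃ d : A, d ≠ 0 ∧ ∀ x : L, x ∈ Algebra.adjoin A (Set.range b) →
      d • x ∈ Submodule.span A (Set.range b) := by
    have hfg : (Subalgebra.toSubmodule (Algebra.adjoin A (Set.range b))).FG := 
      fg_adjoin_of_finite (Set.finite_range b) (Set.forall_mem_range.2 hb)
    obtain ⟨S, hS⟩ := hfg
    choose d hd hd' using fun x : L => exists_smul_mem_span (A := A) b x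
    refine ⟨∏ x ∈ S, d x, Finset.prod_ne_zero_iff.2 fun x _ => hd x, fun x hx => ?_⟩
    have hle : Submodule.span A (S : Set L) ≤
        (Submodule.span A (Set.range b)).comap (LinearMap.lsmul A L (∏ x ∈ S, d x)) := by
      rw [Submodule.span_le]
      intro y hy
      change (∏ x ∈ S, d x) • y ∈ Submodule.span A (Set.range b)
      rw [← Finset.prod_erase_mul S d hy, mul_smul]
      exact Submodule.smul_mem _ _ (hd' y)
    rw [hS] at hle
    exact hle hx
  have hfin : (Ideal.span {a}).minimalPrimes.Finite := 
    Ideal.finite_minimalPrimes_of_isNoetherianRing A _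
  -- Since `a ≠ 0`, a height one prime containing `a` is minimal over it, whence the finiteness.
  have hmin (p : Ideal A) (hp : p.IsPrime) (hp1 : p.height = 1) (hap : a ∈ p) :
      p ∈ hfin.toFinset := by
    rw [Set.Finite.mem_toFinset]
    refine ⟨⟨hp, by simpa [Ideal.span_le] using hap⟩, ?_⟩
    rintro Q ⟨hQ, hQa⟩ hQp
    by_contra hlt
    have hlt : Q < p := lt_of_le_of_ne hQp (fun h => hlt h.ge)
    have hQ0 : Q ≠ ⊥ := by
      rintro rfl
      exact ha0 (hQa (Ideal.mem_span_singleton_self a))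
    have h1 := Ideal.height_add_one_le_of_lt_of_isPrime hlt
    have h2 : Q.height ≠ 0 := Ideal.height_eq_zero_iff_eq_bot.not.2 hQ0
    rw [hp1] at h1
    have h3 : (1 : ℕ∞) + 1 ≤ 1 := (add_le_add_left (Order.one_le_iff_ne_zero.2 h2) 1).trans h1
    exact absurd h3 (by decide)
  have hloc (p : Ideal A) : ∃ c : A, c ≠ 0 ∧ (p.IsPrime → p.height = 1 →
      ∀ x : L, IsIntegral A x → ∀ i, ∃ s ∉ p, ∃ a : A, s • b.repr (c • x) i = algebraMap A K a) := by
    by_cases hp : p.IsPrime ∧ p.height = 1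
    · have := hp.1
      obtain ⟨c, hc, h⟩ := exists_smul_repr_mem_range_of_height_eq_one hq b hb hp.2 (hA.isGRing p)
      exact ⟨c, hc, fun _ _ => h⟩
    · exact ⟨1, one_ne_zero, fun h1 h2 => absurd ⟨h1, h2⟩ hp⟩
  choose c hc hc' using hloc
  refine ⟨d₀ * ∏ p ∈ hfin.toFinset, c p,
    mul_ne_zero hd₀ (Finset.prod_ne_zero_iff.2 fun p _ => hc p), fun x hx => ?_⟩
  set d := d₀ * ∏ p ∈ hfin.toFinset, c p with hd
  have hrange (i : ι) : b.repr (d • x) i ∈ (algebraMap A K).range := by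
    refine IsIntegrallyClosed.mem_range_algebraMap_of_height_eq_one fun p hp hp1 => ?_
    have hsm (r : A) (y : L) : b.repr (r • y) i = r • b.repr y i := by
      rw [← algebraMap_smul K r y, map_smul, Finsupp.smul_apply, algebraMap_smul]
    by_cases hap : a ∈ p
    · obtain ⟨s, hs, e, he⟩ := hc' p hp hp1 x hx i
      refine ⟨s, hs, d₀ * (∏ p ∈ hfin.toFinset.erase p, c p) * e, ?_⟩
      rw [hd, ← Finset.prod_erase_mul _ _ (hmin p hp hp1 hap), ← mul_assoc, mul_smul, hsm,
        smul_comm, he, Algebra.smul_def, ← map_mul]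
    · obtain ⟨s, hs, h⟩ := ha p hp hp1 hap x hx
      obtain ⟨v, hv⟩ := (Submodule.mem_span_range_iff_exists_fun A).1 (hspan _ h)
      refine ⟨s, hs, (∏ p ∈ hfin.toFinset, c p) * v i, ?_⟩
      have h2 : b.repr (d₀ • s • x) i = algebraMap A K (v i) := by
        rw [← hv]
        simp_rw [← algebraMap_smul K (v _)]
        rw [b.repr_sum_self]
      rw [← hsm, smul_comm, hd, mul_comm, mul_smul, hsm, h2, Algebra.smul_def, ← map_mul]
  choose v hv using hrange
  refine (Submodule.mem_span_range_iff_exists_fun A).2 ⟨v, ?_⟩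
  conv_rhs => rw [← b.sum_repr (d • x)]
  refine Finset.sum_congr rfl fun i _ => ?_
  rw [← hv i, algebraMap_smul]

end Insep

/-! ### Finiteness of integral closure over excellent normal domains -/

section Nagata

variable {A K L : Type u} [CommRing A] [IsDomain A] [IsIntegrallyClosed A]
  [Field K] [Algebra A K] [IsFractionRing A K] [Field L] [Algebra K L] [Algebra A L]
  [IsScalarTower A K L] [FiniteDimensional K L]

theorem PlusRegular.IsExcellentRing.finite_integralClosure_of_isPurelyInseparable
    (hA : PlusRegular.IsExcellentRing A) [IsPurelyInseparable K L] :
    Module.Finite A (integralClosure A L) := by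
  have := hA.isNoetherianRing
  obtain ⟨ℓ, hℓ⟩ := ExpChar.exists K
  have hℓL : ExpChar L ℓ := expChar_of_injective_algebraMap (algebraMap K L).injective ℓ
  obtain ⟨n, hn⟩ : ∃ n, ∀ x : L, x ^ ℓ ^ n ∈ (algebraMap K L).range :=
    ⟨_, IsPurelyInseparable.exponent_def' K ℓ⟩
  obtain ⟨s, b, hb⟩ := FiniteDimensional.exists_is_basis_integral A K L
  obtain ⟨d, hd, h⟩ := exists_smul_mem_span_of_isExcellentRing hA hn b hb
  have hd' : algebraMap A L d ≠ 0 := by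
    rw [IsScalarTower.algebraMap_apply A K L, Ne, map_eq_zero,
      map_eq_zero_iff _ (IsFractionRing.injective A K)]
    exact hd
  let φ : integralClosure A L →ₗ[A] Submodule.span A (Set.range b) :=
    ((LinearMap.lsmul A L d).comp (integralClosure A L).val.toLinearMap).codRestrict _
      fun x => h x x.2
  have : IsNoetherian A (Submodule.span A (Set.range b)) :=
    isNoetherian_span_of_finite A (Set.finite_range b)
  refine Module.Finite.of_injective φ fun x y hxy => Subtype.ext ?_
  have h1 : d • (x : L) = d • (y : L) := congrArg Subtype.val hxy
  rw [Algebra.smul_def, Algebra.smul_def] at h1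
  exact mul_left_cancel₀ hd' h1

/-- Finiteness over the normal ring `B` in a separable extension is classical, and finiteness of `B`
over the Noetherian ring `A` carries it down. -/
theorem Module.Finite.integralClosure_of_isSeparable (A B F L : Type u) [CommRing A]
    [IsNoetherianRing A] [CommRing B] [IsDomain B] [IsIntegrallyClosed B] [Algebra A B]
    [Module.Finite A B] [Field F] [Algebra B F] [IsFractionRing B F] [Field L] [Algebra F L]
    [Algebra A L] [Algebra B L] [IsScalarTower A B L] [IsScalarTower B F L]
    [FiniteDimensional F L] [Algebra.IsSeparable F L] : Module.Finite A (integralClosure A L) := by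
  have : IsNoetherianRing B := IsNoetherianRing.of_finite A B
  have h2 : Module.Finite B (integralClosure B L) := IsIntegralClosure.finite B F L _
  have h3 : Module.Finite A (integralClosure B L) := Module.Finite.trans B _
  let φ : integralClosure A L →ₗ[A] integralClosure B L :=
    { toFun := fun x => ⟨x, IsIntegral.tower_top x.2⟩
      map_add' := fun _ _ => rfl
      map_smul' := fun _ _ => rfl }
  exact Module.Finite.of_injective φ fun x y hxy => Subtype.ext (congrArg Subtype.val hxy :)

/-- The fixed field `F` of all automorphisms splits the extension: `L / F` is Galois and `F / K` is
purely inseparable. -/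
theorem PlusRegular.IsExcellentRing.finite_integralClosure_of_normal
    (hA : PlusRegular.IsExcellentRing A) [Normal K L] :
    Module.Finite A (integralClosure A L) := by
  have := hA.isNoetherianRing
  let F := IntermediateField.fixedField (⊤ : Subgroup Gal(L/K))
  have : IsGalois F L := IsGalois.of_fixed_field L (⊤ : Subgroup Gal(L/K))
  have : IsPurelyInseparable K F := by
    refine isPurelyInseparable_iff.2 fun x =>
      ⟨Algebra.IsIntegral.isIntegral x, fun hx => ?_⟩
    refine minpoly.mem_range_of_degree_eq_one K x ?_
    have hmin : minpoly K (x : L) = minpoly K x :=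
      minpoly.algebraMap_eq (algebraMap F L).injective x
    have hsplit : ((minpoly K x).map (algebraMap K L)).Splits := hmin ▸ Normal.splits inferInstance _
    -- Every root of the minimal polynomial of `x` is conjugate to `x`, hence equal to `x` because
    -- `x` is fixed. A separable polynomial with one root has degree one.
    have hroots : ((minpoly K x).map (algebraMap K L)).roots ≤ {(x : L)} := by
      rw [Multiset.le_iff_subset (Polynomial.nodup_roots (Polynomial.Separable.map hx))]
      intro y hy
      rw [Polynomial.mem_roots (Polynomial.map_ne_zero (minpoly.ne_zero
        (Algebra.IsIntegral.isIntegral x))), Polynomial.IsRoot, Polynomial.eval_map_algebraMap] at hy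
      have h1 : minpoly K x = minpoly K y := minpoly.eq_of_irreducible_of_monic
        (minpoly.irreducible (Algebra.IsIntegral.isIntegral x)) hy
        (minpoly.monic (Algebra.IsIntegral.isIntegral x))
      obtain ⟨σ, hσ⟩ := (Normal.minpoly_eq_iff_mem_orbit L).1 (hmin.trans h1)
      rw [Multiset.mem_singleton]
      have h2 : σ⁻¹ (x : L) = y := by
        rw [← hσ]; exact inv_smul_smul σ y
      rw [← h2]
      exact x.2 ⟨σ⁻¹, trivial⟩
    have hcard := Multiset.card_le_card hroots
    rw [Multiset.card_singleton, ← hsplit.natDegree_eq_card_roots, Polynomial.natDegree_map] at hcard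
    have hpos := minpoly.natDegree_pos (A := K) (Algebra.IsIntegral.isIntegral x)
    rw [Polynomial.degree_eq_natDegree (minpoly.ne_zero (Algebra.IsIntegral.isIntegral x)),
      le_antisymm hcard hpos]
    rfl
  have h1 := hA.finite_integralClosure_of_isPurelyInseparable (K := K) (L := F)
  have : IsFractionRing (integralClosure A F) F :=
    integralClosure.isFractionRing_of_finite_extension K F
  have : IsIntegrallyClosed (integralClosure A F) :=
    integralClosure.isIntegrallyClosedOfFiniteExtension K
  have : IsScalarTower A (integralClosure A F) L := .of_algebraMap_eq fun x => rfl
  exact Module.Finite.integralClosure_of_isSeparable A (integralClosure A F) F L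

theorem PlusRegular.IsExcellentRing.finite_integralClosure (A K L : Type u) [CommRing A]
    [IsDomain A] [IsIntegrallyClosed A] [Field K] [Algebra A K] [IsFractionRing A K] [Field L]
    [Algebra K L] [Algebra A L] [IsScalarTower A K L] [FiniteDimensional K L]
    (hA : PlusRegular.IsExcellentRing A) :
    Module.Finite A (integralClosure A L) := by
  have := hA.isNoetherianRing
  have : IsScalarTower A L (IntermediateField.normalClosure K L (AlgebraicClosure L)) :=
    .of_algebraMap_eq fun x => Subtype.ext rfl
  have := hA.finite_integralClosure_of_normal (K := K)
    (L := IntermediateField.normalClosure K L (AlgebraicClosure L))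
  let φ := (IsScalarTower.toAlgHom A L
    (IntermediateField.normalClosure K L (AlgebraicClosure L))).mapIntegralClosure
  refine Module.Finite.of_injective φ.toLinearMap fun x y hxy => Subtype.ext ?_
  exact (algebraMap L (IntermediateField.normalClosure K L (AlgebraicClosure L))).injective
    (congrArg Subtype.val hxy)

end Nagata

/-! ### Orders of vanishing -/

open IsLocalRing in
theorem Ring.toNat_ord_map {R S : Type*} [CommRing R] [IsDomain R] [IsDiscreteValuationRing R]
    [CommRing S] [IsDomain S] (φ : R →+* S) (hφ : Function.Injective φ) {h : R} (hh : h ≠ 0) :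
    (Ring.ord S (φ h)).toNat =
      (Module.length S (S ⧸ (maximalIdeal R).map φ)).toNat * (Ring.ord R h).toNat := by
  obtain ⟨ϖ, hϖ⟩ := IsDiscreteValuationRing.exists_irreducible R
  obtain ⟨n, u, rfl⟩ := IsDiscreteValuationRing.eq_unit_mul_pow_irreducible hh hϖ
  have h1 : φ ϖ ≠ 0 := (map_ne_zero_iff φ hφ).2 hϖ.ne_zero
  rw [map_mul, map_pow, Ring.ord_mul_of_isUnit_left (u.isUnit.map φ),
    Ring.ord_mul_of_isUnit_left u.isUnit, Ring.ord_pow (by simpa using h1),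
    Ring.ord_pow (by simpa using hϖ.ne_zero), Ring.ord_of_irreducible hϖ, hϖ.maximalIdeal_eq,
    Ideal.map_span, Set.image_singleton, ← Ring.ord]
  simp [mul_comm]

namespace AlgebraicGeometry.Scheme

variable {X : Scheme.{u}} [IsIntegral X] [IsLocallyNoetherian X]

theorem ord_algebraMap {x : X} (hx : Order.coheight x = 1) {b : X.presheaf.stalk x}
    (hb : b ≠ 0) :
    Scheme.ord (algebraMap (X.presheaf.stalk x) X.functionField b) x =
      ((Ring.ord (X.presheaf.stalk x) b).toNat : ℤ) := by
  have : Ring.KrullDimLE 1 (X.presheaf.stalk x) := krullDimLE_of_coheight_le hx.le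
  rw [Scheme.ord_eq_iff hx ((map_ne_zero_iff _ (IsFractionRing.injective _ _)).2 hb)]
  change Ring.ordFrac (X.presheaf.stalk x) _ = _
  rw [Ring.ordFrac_eq_ord _ hb, Ring.ordMonoidWithZeroHom_eq_coe _ (by simpa using hb)
    (ENat.natCast_toNat (Ring.ord_ne_top (by simpa using hb))).symm]

theorem ord_germToFunctionField {x : X} (hx : Order.coheight x = 1) {U : X.Opens} [Nonempty U]
    (hxU : x ∈ U) {a : Γ(X, U)} (ha : X.presheaf.germ U x hxU a ≠ 0) :
    Scheme.ord (X.germToFunctionField U a) x =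
      ((Ring.ord (X.presheaf.stalk x) (X.presheaf.germ U x hxU a)).toNat : ℤ) := by
  rw [← algebraMap_germ_eq_germToFunctionField _ hxU, ord_algebraMap hx ha]

theorem ord_pow {x : X} {φ : X.functionField} (hφ : φ ≠ 0) (n : ℕ) :
    Scheme.ord (φ ^ n) x = n * Scheme.ord φ x := by
  induction n with
  | zero =>
    have h := Scheme.ord_mul (x := x) (one_ne_zero (α := X.functionField)) one_ne_zero
    simp only [mul_one] at h
    rw [pow_zero]
    push_cast
    omega
  | succ n ih =>
    rw [pow_succ, Scheme.ord_mul (pow_ne_zero _ hφ) hφ, ih]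
    push_cast
    ring

theorem exists_algebraMap_eq_of_ord_nonneg [PlusRegular.IsNormalScheme X] {x : X}
    (hx : Order.coheight x = 1) {φ : X.functionField} (hφ : φ ≠ 0) (h : 0 ≤ Scheme.ord φ x) :
    ∃ b, algebraMap (X.presheaf.stalk x) X.functionField b = φ := by
  have := PlusRegular.isDiscreteValuationRing_stalk X hx
  obtain ⟨a, b, hb, rfl⟩ := IsFractionRing.div_surjective (A := X.presheaf.stalk x) φ
  have hb0 : algebraMap (X.presheaf.stalk x) X.functionField b ≠ 0 := by
    simpa using hb
  have ha0 : algebraMap (X.presheaf.stalk x) X.functionField a ≠ 0 := fun h => hφ (by simp [h])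
  have ha : a ≠ 0 := fun h => ha0 (by simp [h])
  have hb : b ≠ 0 := fun h => hb0 (by simp [h])
  have h1 := Scheme.ord_mul (x := x) hφ hb0
  rw [div_mul_cancel₀ _ hb0, ord_algebraMap hx ha, ord_algebraMap hx hb] at h1
  have h2 : (Ring.ord (X.presheaf.stalk x) b).toNat ≤ (Ring.ord (X.presheaf.stalk x) a).toNat := by
    omega
  have h3 : Ring.ord (X.presheaf.stalk x) b ≤ Ring.ord (X.presheaf.stalk x) a := by
    have := ENat.natCast_toNat (Ring.ord_ne_top (a := a) (by simpa using ha))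
    have := ENat.natCast_toNat (Ring.ord_ne_top (a := b) (by simpa using hb))
    rw [← ‹_ = Ring.ord _ a›, ← ‹_ = Ring.ord _ b›]
    exact_mod_cast h2
  rw [Ring.ord_eq_addVal, Ring.ord_eq_addVal, IsDiscreteValuationRing.addVal_le_iff_dvd] at h3
  obtain ⟨c, rfl⟩ := h3
  exact ⟨c, by rw [map_mul, mul_div_cancel_left₀ _ hb0]⟩

end AlgebraicGeometry.Scheme

/-! ### Irreducible components of normal schemes -/

namespace PlusRegular

variable {X : Scheme.{u}}

theorem germ_injective_of_isAffineOpen {U : X.Opens} (hU : IsAffineOpen U) [IsDomain Γ(X, U)]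
    {x : X} (hx : x ∈ U) : Function.Injective (X.presheaf.germ U x hx) := by
  algebraize [(X.presheaf.germ U x hx).hom]
  have := hU.isLocalization_stalk ⟨x, hx⟩
  exact IsLocalization.injective (X.presheaf.stalk x)
    (hU.primeIdealOf ⟨x, hx⟩).asIdeal.primeCompl_le_nonZeroDivisors

theorem isIrreducible_of_isAffineOpen {U : X.Opens} (hU : IsAffineOpen U) [IsDomain Γ(X, U)]
    [Nonempty U] : IsIrreducible (U : Set X) := by
  have : IsAffine U := hU
  have : IsDomain Γ(U, ⊤) := (U.topIso.commRingCatIsoToRingEquiv.toMulEquiv).isDomain _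
  have := isIntegral_of_isAffine_of_isDomain U
  have h := (IrreducibleSpace.isIrreducible_univ U).image U.ι U.ι.continuous.continuousOn
  simpa using h

/-- An irreducible open set containing a point of the component also contains `ξ`, so its closure
contains the component and equals it by maximality. -/
theorem le_closure_of_mem {ξ x : X} (hξ : closure {ξ} ∈ irreducibleComponents X)
    (hx : x ∈ closure {ξ}) {U : X.Opens} (hU : IsIrreducible (U : Set X)) (hxU : x ∈ U) :
    (U : Set X) ⊆ closure {ξ} := by
  have h1 : ξ ∈ U := (specializes_iff_mem_closure.2 hx).mem_open U.isOpen hxU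
  have h2 : closure {ξ} ⊆ closure (U : Set X) :=
    closure_mono (Set.singleton_subset_iff.2 h1)
  exact subset_closure.trans (hξ.2 hU.closure h2)

theorem exists_closure_mem_irreducibleComponents (x : X) :
    ∃ ξ : X, ξ ⤳ x ∧ closure {ξ} ∈ irreducibleComponents X := by
  obtain ⟨ξ, hξ⟩ := QuasiSober.sober (S := irreducibleComponent x)
    isIrreducible_irreducibleComponent isClosed_irreducibleComponent
  refine ⟨ξ, specializes_iff_mem_closure.2 ?_, ?_⟩
  · rw [hξ.def]
    exact mem_irreducibleComponent
  · rw [hξ.def]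
    exact irreducibleComponent_mem_irreducibleComponents x

variable [IsNormalScheme X]

instance (priority := 900) IsNormalScheme.isReduced : IsReduced X :=
  have (x : X) : _root_.IsReduced (X.presheaf.stalk x) :=
    have := IsNormalScheme.isDomain x
    inferInstance
  isReduced_of_isReduced_stalk X

theorem exists_isAffineOpen_isDomain [IsLocallyNoetherian X] {x : X} {V : X.Opens} (hx : x ∈ V) :
    ∃ U : X.Opens, x ∈ U ∧ U ≤ V ∧ IsAffineOpen U ∧ IsDomain Γ(X, U) := by
  obtain ⟨U, hxU, hU, hUV, h⟩ := X.exists_le_and_germ_injective x V hx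
  have := IsNormalScheme.isDomain x
  exact ⟨U, hxU, hUV, hU, Function.Injective.isDomain (X.presheaf.germ U x hxU).hom h⟩

/-- Each point has an affine neighbourhood whose ring is a domain; being irreducible, it stays in a
single component. -/
theorem isOpen_closure_singleton [IsLocallyNoetherian X] {ξ : X}
    (hξ : closure {ξ} ∈ irreducibleComponents X) : IsOpen (closure {ξ}) := by
  rw [isOpen_iff_forall_mem_open]
  intro x hx
  obtain ⟨U, hxU, -, hU, _⟩ := exists_isAffineOpen_isDomain (V := ⊤) (Set.mem_univ x)
  have : Nonempty U := ⟨x, hxU⟩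
  exact ⟨U, le_closure_of_mem hξ hx (isIrreducible_of_isAffineOpen hU) hxU, U.isOpen, hxU⟩

theorem isField_stalk {ξ : X} (hξ : closure {ξ} ∈ irreducibleComponents X) :
    IsField (X.presheaf.stalk ξ) :=
  isField_stalk_of_closure_mem_irreducibleComponents X ξ hξ

theorem germ_injective_of_subset_closure [IsLocallyNoetherian X] {ξ : X} {U : X.Opens}
    (hU : (U : Set X) ⊆ closure {ξ}) (hξ : ξ ∈ U) :
    Function.Injective (X.presheaf.germ U ξ hξ) := by
  rw [injective_iff_map_eq_zero]
  intro a ha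
  refine TopCat.Presheaf.section_ext X.sheaf U a 0 fun x hx => ?_
  obtain ⟨V, hxV, hVU, hV, _⟩ := exists_isAffineOpen_isDomain hx
  have hξV : ξ ∈ V := (specializes_iff_mem_closure.2 (hU hx)).mem_open V.isOpen hxV
  have h1 : X.presheaf.map (homOfLE hVU).op a = 0 := by
    apply germ_injective_of_isAffineOpen hV hξV
    rw [map_zero, TopCat.Presheaf.germ_res_apply]
    exact ha
  have h2 := congrArg (X.presheaf.germ V x hxV) h1
  rw [TopCat.Presheaf.germ_res_apply] at h2
  rw [map_zero] at h2
  exact h2.trans (map_zero _).symm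

theorem germ_injective_of_mem [IsLocallyNoetherian X] {ξ x : X} {U : X.Opens}
    (hU : (U : Set X) ⊆ closure {ξ}) (hx : x ∈ U) :
    Function.Injective (X.presheaf.germ U x hx) := by
  have h : ξ ⤳ x := specializes_iff_mem_closure.2 (hU hx)
  have h1 := germ_injective_of_subset_closure hU (h.mem_open U.isOpen hx)
  rw [← X.presheaf.germ_stalkSpecializes hx h] at h1
  exact Function.Injective.of_comp h1

theorem isDomain_of_subset_closure [IsLocallyNoetherian X] {ξ : X} {U : X.Opens}
    (hU : (U : Set X) ⊆ closure {ξ}) (hξ : ξ ∈ U) : IsDomain Γ(X, U) :=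
  have := IsNormalScheme.isDomain ξ
  Function.Injective.isDomain (X.presheaf.germ U ξ hξ).hom (germ_injective_of_subset_closure hU hξ)

end PlusRegular

/-! ### Morphisms with `𝒪_X = π_* 𝒪_Y` -/

namespace PlusRegular

section

variable {X Y : Scheme.{u}} (π : Y ⟶ X) (hπ : ∀ U : X.Opens, IsIso (π.app U))
include hπ

theorem app_bijective (U : X.Opens) : Function.Bijective (π.app U) :=
  have := hπ U
  ConcreteCategory.bijective_of_isIso (π.app U)

/-- An empty preimage has zero ring of sections, whereas a nonempty open set of `X` does not. -/
theorem exists_mem_preimage {U : X.Opens} {x : X} (hx : x ∈ U) : ∃ y, π y ∈ U := by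
  by_contra! h
  have h1 : π ⁻¹ᵁ U = ⊥ := by
    ext y
    simpa using h y
  have h2 : Subsingleton Γ(Y, π ⁻¹ᵁ U) := by
    rw [h1]
    infer_instance
  have : Nonempty U := ⟨x, hx⟩
  exact not_subsingleton Γ(X, U) (app_bijective π hπ U).1.subsingleton

/-- An open and closed `C` meeting the preimage without containing it would write its ring of
sections, a domain isomorphic to `Γ(X, U)`, as a product of two nonzero rings. -/
theorem preimage_le_of_isClosed {U : X.Opens} [IsDomain Γ(X, U)] {C : Y.Opens}
    (hC : IsClosed (C : Set Y)) {y : Y} (hy : y ∈ C) (hyU : π y ∈ U) : π ⁻¹ᵁ U ≤ C := by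
  intro z hz
  by_contra hzC
  let W₁ : Y.Opens := π ⁻¹ᵁ U ⊓ C
  let W₂ : Y.Opens := π ⁻¹ᵁ U ⊓ ⟨(C : Set Y)ᶜ, hC.isOpen_compl⟩
  have hsup : π ⁻¹ᵁ U = W₁ ⊔ W₂ := by
    refine le_antisymm (fun z hz => ?_) (sup_le inf_le_left inf_le_left)
    by_cases h : z ∈ C
    · exact Or.inl ⟨hz, h⟩
    · exact Or.inr ⟨hz, h⟩
  have hinf : W₁ ⊓ W₂ = ⊥ := by
    ext x
    constructor
    · rintro ⟨h, h'⟩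
      exact (h'.2 h.2).elim
    · exact False.elim
  have : Nonempty W₁ := ⟨y, hyU, hy⟩
  have : Nonempty W₂ := ⟨z, hz, hzC⟩
  have := hπ U
  have hd : IsDomain Γ(Y, π ⁻¹ᵁ U) :=
    (asIso (π.app U)).symm.commRingCatIsoToRingEquiv.toMulEquiv.isDomain _
  rw [hsup] at hd
  let e : Γ(Y, W₁ ⊔ W₂) ≅ CommRingCat.of (Γ(Y, W₁) × Γ(Y, W₂)) :=
    (Y.sheaf.isProductOfDisjoint W₁ W₂ hinf).conePointUniqueUpToIso (CommRingCat.prodFanIsLimit _ _)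
  have : IsDomain (Γ(Y, W₁) × Γ(Y, W₂)) :=
    e.symm.commRingCatIsoToRingEquiv.toMulEquiv.isDomain _
  exact false_of_nontrivial_of_product_domain Γ(Y, W₁) Γ(Y, W₂)

variable [IsNormalScheme X] [IsNormalScheme Y] [IsLocallyNoetherian X] [IsLocallyNoetherian Y]

/-- Components are open on both sides, and the preimage of a component of `X` is nonempty and cannot
be split by an open and closed set; hence it is exactly one component of `Y`. -/
theorem exists_genericPoint_preimage {ξ : X} (hξ : closure {ξ} ∈ irreducibleComponents X) :
    ∃ η : Y, π η = ξ ∧ closure {η} ∈ irreducibleComponents Y ∧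
      π ⁻¹' closure {ξ} = closure {η} := by
  let X₀ : X.Opens := ⟨closure {ξ}, isOpen_closure_singleton hξ⟩
  have hξ₀ : ξ ∈ X₀ := subset_closure rfl
  have : IsDomain Γ(X, X₀) := isDomain_of_subset_closure subset_rfl hξ₀
  obtain ⟨y, hy⟩ := exists_mem_preimage π hπ hξ₀
  obtain ⟨η, hηy, hη⟩ := exists_closure_mem_irreducibleComponents y
  have h1 : π ⁻¹ᵁ X₀ ≤ ⟨closure {η}, isOpen_closure_singleton hη⟩ :=
    preimage_le_of_isClosed π hπ isClosed_closure (specializes_iff_mem_closure.1 hηy) hy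
  have h2 : π η ∈ X₀ := (hηy.map π.continuous).mem_open X₀.isOpen hy
  refine ⟨η, ?_, hη, Set.Subset.antisymm h1 ?_⟩
  · have h3 : ξ ⤳ π η := specializes_iff_mem_closure.2 h2
    refine (Specializes.antisymm (by_contra fun h => ?_) h3).eq
    -- If `π η` were not generic, removing its closure would leave a nonempty open set of `X`
    -- without preimage.
    let U : X.Opens := X₀ ⊓ ⟨(closure {π η})ᶜ, isClosed_closure.isOpen_compl⟩
    have hU : ξ ∈ U := ⟨hξ₀, fun h' => h (specializes_iff_mem_closure.2 h')⟩
    obtain ⟨z, hz⟩ := exists_mem_preimage π hπ hU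
    have h4 : η ⤳ z := specializes_iff_mem_closure.2 (h1 hz.1)
    exact hz.2 (specializes_iff_mem_closure.1 (h4.map π.continuous))
  · exact closure_minimal (Set.singleton_subset_iff.2 h2) (isClosed_closure.preimage π.continuous)

/-- Inside a component germs are injective on both `X` and `Y`, and `π` is bijective on sections. -/
theorem stalkMap_injective (y : Y) : Function.Injective (π.stalkMap y) := by
  obtain ⟨ξ, hξy, hξ⟩ := exists_closure_mem_irreducibleComponents (π y)
  obtain ⟨η, rfl, hη, h⟩ := exists_genericPoint_preimage π hπ hξ
  have hηy : η ⤳ y := by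
    rw [specializes_iff_mem_closure, ← h]
    exact specializes_iff_mem_closure.1 hξy
  rw [injective_iff_map_eq_zero]
  intro a ha
  obtain ⟨U, hyU, a, rfl⟩ := X.presheaf.exists_germ_eq a
  let V : X.Opens := U ⊓ ⟨closure {π η}, isOpen_closure_singleton hξ⟩
  have hyV : π y ∈ V := ⟨hyU, specializes_iff_mem_closure.1 hξy⟩
  have hV : (π ⁻¹ᵁ V : Set Y) ⊆ closure {η} := fun z hz => by
    rw [← h]
    exact hz.2
  rw [← TopCat.Presheaf.germ_res_apply X.presheaf (homOfLE inf_le_left : V ⟶ U) _ hyV a] at ha ⊢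
  rw [Scheme.Hom.germ_stalkMap_apply, map_eq_zero_iff _ (germ_injective_of_mem hV hyV),
    map_eq_zero_iff _ (app_bijective π hπ V).1] at ha
  rw [ha, map_zero]

end

end PlusRegular

/-! ### Normalization in a finite extension of a function field -/

namespace PlusRegular

variable {Y : Scheme.{u}}

theorem fromSpecStalk_appLE {η : Y} {R : CommRingCat.{u}} (φ : Y.presheaf.stalk η ⟶ R)
    {V : Y.Opens} (hV : η ∈ V) (h : ⊤ ≤ (Spec.map φ ≫ Y.fromSpecStalk η) ⁻¹ᵁ V) :
    (Spec.map φ ≫ Y.fromSpecStalk η).appLE V ⊤ h ≫ (Scheme.ΓSpecIso R).hom =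
      Y.presheaf.germ V η hV ≫ φ := by
  have h' : ⊤ ≤ Spec.map φ ⁻¹ᵁ Y.fromSpecStalk η ⁻¹ᵁ V := h
  have h1 : (Spec.map φ ≫ Y.fromSpecStalk η).appLE V ⊤ h =
      (Y.fromSpecStalk η).app V ≫ (Spec.map φ).appLE _ ⊤ h' :=
    Scheme.Hom.comp_appLE _ _ _ _ _
  have h2 : (Spec (Y.presheaf.stalk η)).presheaf.map
      (homOfLE (le_top : Y.fromSpecStalk η ⁻¹ᵁ V ≤ ⊤)).op ≫ (Spec.map φ).appLE _ ⊤ h' =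
        (Spec.map φ).appTop :=
    (Scheme.Hom.map_appLE _ _ _).trans (Scheme.Hom.appLE_eq_app (Spec.map φ))
  rw [h1, Scheme.fromSpecStalk_app hV, Category.assoc, Category.assoc, Category.assoc,
    reassoc_of% h2, Scheme.ΓSpecIso_naturality, Iso.inv_hom_id_assoc]

/-- The morphism `Spec L ⟶ Y` given by a map from the local ring at `η` to a field `L`. -/
noncomputable def fromSpecField (η : Y) {L : Type u} [Field L] (i : Y.presheaf.stalk η →+* L) :
    Spec (.of L) ⟶ Y :=
  Spec.map (CommRingCat.ofHom i) ≫ Y.fromSpecStalk η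

variable {η : Y} {L : Type u} [Field L] (i : Y.presheaf.stalk η →+* L)

theorem fromSpecField_apply (hi : IsLocalHom i) (x : Spec (.of L)) :
    fromSpecField η i x = η := by
  have h1 : x = IsLocalRing.closedPoint L := Subsingleton.elim (α := PrimeSpectrum L) _ _
  rw [fromSpecField, Scheme.Hom.comp_apply, h1]
  have h2 : Spec.map (CommRingCat.ofHom i) (IsLocalRing.closedPoint L) =
      IsLocalRing.closedPoint (Y.presheaf.stalk η) :=
    IsLocalRing.comap_closedPoint i
  rw [h2, Scheme.fromSpecStalk_closedPoint]

theorem fromSpecField_preimage (hi : IsLocalHom i) {V : Y.Opens} (hV : η ∈ V) :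
    ⊤ ≤ fromSpecField η i ⁻¹ᵁ V := by
  intro x _
  change fromSpecField η i x ∈ V
  rwa [fromSpecField_apply i hi]

theorem fromSpecField_appLE (hi : IsLocalHom i) {V : Y.Opens} (hV : η ∈ V) :
    (fromSpecField η i).appLE V ⊤ (fromSpecField_preimage i hi hV) ≫
      (Scheme.ΓSpecIso (.of L)).hom = Y.presheaf.germ V η hV ≫ CommRingCat.ofHom i := by
  have h := fromSpecStalk_appLE (CommRingCat.ofHom i) hV (fromSpecField_preimage i hi hV)
  exact h

/-- Sections of the relative normalization over `V` are an integral closure in `Γ(Spec L, k⁻¹ V)`.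
Transport along the identification with `L` realizes the charts as subrings of one field. -/
theorem exists_normalization_chart [IsLocallyNoetherian Y] (hi : IsLocalHom i) {V : Y.Opens}
    (hV : IsAffineOpen V) (hη : η ∈ V) :
    ∃ c : Γ((fromSpecField η i).normalization, (fromSpecField η i).fromNormalization ⁻¹ᵁ V) →+* L,
      Function.Injective c ∧
      (∀ b, c ((fromSpecField η i).fromNormalization.app V b) = i (Y.presheaf.germ V η hη b)) ∧
      ∀ x, x ∈ c.range ↔ (i.comp (Y.presheaf.germ V η hη).hom).IsIntegralElem x := by
  have hk := fromSpecField_appLE i hi hη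
  have htop := fromSpecField_preimage i hi hη
  set k := fromSpecField η i
  let m : Γ(Spec (.of L), k ⁻¹ᵁ V) ⟶ .of L :=
    (Spec (.of L)).presheaf.map (homOfLE htop).op ≫ (Scheme.ΓSpecIso (.of L)).hom
  have hm : IsIso m := by
    have : IsIso (homOfLE htop) := ⟨homOfLE le_top, rfl, rfl⟩
    infer_instance
  have hkm : k.app V ≫ m = Y.presheaf.germ V η hη ≫ CommRingCat.ofHom i := by
    rw [← hk, Scheme.Hom.appLE, Category.assoc]
  algebraize [(k.app V).hom]
  let v : integralClosure Γ(Y, V) Γ(Spec (.of L), k ⁻¹ᵁ V) →+* Γ(Spec (.of L), k ⁻¹ᵁ V) :=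
    (integralClosure Γ(Y, V) Γ(Spec (.of L), k ⁻¹ᵁ V)).val.toRingHom
  refine ⟨m.hom.comp (v.comp (k.normalizationObjIso hV).hom.hom), ?_, ?_, ?_⟩
  · exact (ConcreteCategory.bijective_of_isIso m).1.comp (Subtype.val_injective.comp
      (ConcreteCategory.bijective_of_isIso (k.normalizationObjIso hV).hom).1)
  · intro b
    have h1 := congrArg (fun f => f b) (congrArg CommRingCat.Hom.hom hkm)
    refine Eq.trans ?_ h1
    have h2 : (k.normalizationObjIso hV).hom.hom (k.fromNormalization.app V b) =
        algebraMap _ _ b := by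
      have := congrArg (fun f => f b) (congrArg CommRingCat.Hom.hom (k.fromNormalization_app hV))
      refine (congrArg (k.normalizationObjIso hV).hom.hom this).trans ?_
      exact ConcreteCategory.congr_hom (k.normalizationObjIso hV).inv_hom_id _
    rw [RingHom.comp_apply, RingHom.comp_apply, h2]
    rfl
  · intro x
    have h1 : (i.comp (Y.presheaf.germ V η hη).hom) = m.hom.comp (k.app V).hom :=
      (congrArg CommRingCat.Hom.hom hkm).symm
    obtain ⟨z, rfl⟩ := (ConcreteCategory.bijective_of_isIso m).2 x
    rw [h1]
    have h3 : (m.hom.comp (k.app V).hom).IsIntegralElem (m.hom z) ↔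
        z ∈ integralClosure Γ(Y, V) Γ(Spec (.of L), k ⁻¹ᵁ V) := by
      constructor
      · rintro ⟨p, hp, hp0⟩
        refine ⟨p, hp, (ConcreteCategory.bijective_of_isIso m).1 ?_⟩
        rw [map_zero, ← hp0]
        exact Polynomial.hom_eval₂ p _ m.hom z
      · rintro ⟨p, hp, hp0⟩
        refine ⟨p, hp, ?_⟩
        rw [← Polynomial.hom_eval₂]
        exact (congrArg m.hom hp0).trans (map_zero _)
    refine Iff.trans ?_ h3.symm
    constructor
    · rintro ⟨w, hw⟩
      rw [← (ConcreteCategory.bijective_of_isIso m).1 hw]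
      exact ((k.normalizationObjIso hV).hom.hom w).2
    · intro hz
      obtain ⟨w, hw⟩ := (ConcreteCategory.bijective_of_isIso (k.normalizationObjIso hV).hom).2 ⟨z, hz⟩
      exact ⟨w, congrArg (fun y => m.hom (v y)) hw⟩

end PlusRegular

/-! ### Finiteness and normality of the normalization over an excellent scheme -/

theorem PlusRegular.IsExcellentRing.finite_of_isIntegralClosure (B K L C : Type u) [CommRing B]
    [IsDomain B] [IsIntegrallyClosed B] [Field K] [Algebra B K] [IsFractionRing B K] [Field L]
    [Algebra K L] [FiniteDimensional K L] [Algebra B L] [IsScalarTower B K L] [CommRing C]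
    [Algebra B C] [Algebra C L] [IsScalarTower B C L] [IsIntegralClosure C B L]
    (hB : PlusRegular.IsExcellentRing B) : Module.Finite B C := by
  have := hB.finite_integralClosure B K L
  exact Module.Finite.equiv (IsIntegralClosure.equiv B (integralClosure B L) L C).toLinearEquiv

theorem IsIntegralClosure.isIntegrallyClosed (B K L C : Type u) [CommRing B]
    [IsDomain B] [IsIntegrallyClosed B] [Field K] [Algebra B K] [IsFractionRing B K] [Field L]
    [Algebra K L] [FiniteDimensional K L] [Algebra B L] [IsScalarTower B K L] [CommRing C]
    [Algebra B C] [Algebra C L] [IsScalarTower B C L] [IsIntegralClosure C B L] :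
    IsIntegrallyClosed C := by
  have : IsIntegrallyClosed (integralClosure B L) :=
    integralClosure.isIntegrallyClosedOfFiniteExtension K
  exact IsIntegrallyClosed.of_equiv (IsIntegralClosure.equiv B (integralClosure B L) L C).toRingEquiv

theorem AlgebraicGeometry.IsAffineOpen.primeIdealOf_surjective {Y : Scheme.{u}} {V : Y.Opens}
    (hV : IsAffineOpen V) : Function.Surjective hV.primeIdealOf :=
  fun (p : Spec Γ(Y, V)) => ⟨hV.isoSpec.inv p, by
    have h : hV.isoSpec.hom (hV.isoSpec.inv p) = p := by
      rw [← Scheme.Hom.comp_apply, Iso.inv_hom_id]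
      rfl
    exact h⟩

namespace PlusRegular

theorem isIntegrallyClosed_of_isAffineOpen {Y : Scheme.{u}} [IsNormalScheme Y] {V : Y.Opens}
    (hV : IsAffineOpen V) [IsDomain Γ(Y, V)] : IsIntegrallyClosed Γ(Y, V) := by
  refine IsIntegrallyClosed.of_localization_maximal fun p _ hp => ?_
  obtain ⟨x, hx⟩ := hV.primeIdealOf_surjective ⟨p, inferInstance⟩
  have h := hV.isLocalization_stalk x
  rw [hx] at h
  have := IsNormalScheme.isIntegrallyClosed x.1
  exact IsIntegrallyClosed.of_equiv
    (IsLocalization.algEquiv p.primeCompl (Y.presheaf.stalk x.1) (Localization.AtPrime p)).toRingEquiv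

theorem isNormalScheme_of_forall_isAffineOpen {T : Scheme.{u}} [IsIntegral T]
    (h : ∀ t : T, ∃ V : T.Opens, t ∈ V ∧ IsAffineOpen V ∧ IsIntegrallyClosed Γ(T, V)) :
    IsNormalScheme T where
  isDomain t := inferInstance
  isIntegrallyClosed t := by
    obtain ⟨V, htV, hV, _⟩ := h t
    have : Nonempty V := ⟨t, htV⟩
    algebraize [(T.presheaf.germ V t htV).hom]
    have := hV.isLocalization_stalk ⟨t, htV⟩
    exact isIntegrallyClosed_of_isLocalization _ (hV.primeIdealOf ⟨t, htV⟩).asIdeal.primeCompl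
      (Ideal.primeCompl_le_nonZeroDivisors _)

end PlusRegular

namespace PlusRegular

variable {Y : Scheme.{u}} {η : Y}
  {L : Type u} [Field L] (i : Y.presheaf.stalk η →+* L)

/-- The normalization of `Y` in the field `L`. -/
noncomputable abbrev normalizationIn [IsLocallyNoetherian Y] : Scheme.{u} :=
  (fromSpecField η i).normalization

/-- The structure morphism of the normalization of `Y` in the field `L`. -/
noncomputable abbrev normalizationInHom [IsLocallyNoetherian Y] : normalizationIn i ⟶ Y :=
  (fromSpecField η i).fromNormalization

theorem isLocalHom_of_isField {R L : Type*} [CommRing R] [Nontrivial R] [Field L] (hR : IsField R)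
    (i : R →+* L) : IsLocalHom i where
  map_nonunit a ha := by
    let := hR.toField
    refine isUnit_iff_ne_zero.2 fun h => ?_
    exact ha.ne_zero (by rw [h, map_zero])

/-- The one point scheme `Spec L` has dense image in the normalization, so its image is the generic
point. -/
theorem normalizationInHom_genericPoint [IsLocallyNoetherian Y] (hi : IsLocalHom i) :
    normalizationInHom i (genericPoint (normalizationIn i)) = η := by
  let p : Spec (.of L) := IsLocalRing.closedPoint L
  have h : IsGenericPoint ((fromSpecField η i).toNormalization p) ⊤ := by
    have h1 := (fromSpecField η i).toNormalization.denseRange.closure_range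
    have h2 : Set.range (fromSpecField η i).toNormalization =
        {(fromSpecField η i).toNormalization p} := by
      ext x
      constructor
      · rintro ⟨q, rfl⟩
        rw [show q = p from Subsingleton.elim (α := PrimeSpectrum L) _ _]
        rfl
      · rintro rfl
        exact ⟨p, rfl⟩
    rw [h2] at h1
    exact h1
  rw [← h.eq (genericPoint_spec _), ← Scheme.Hom.comp_apply,
    Scheme.Hom.toNormalization_fromNormalization, fromSpecField_apply i hi]

/-- The stalk at `η` is a field, so the prime of `η` in a domain chart is zero. -/
theorem isFractionRing_stalk [IsNormalScheme Y] (hη : closure {η} ∈ irreducibleComponents Y) {V : Y.Opens}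
    (hV : IsAffineOpen V) [IsDomain Γ(Y, V)] (hηV : η ∈ V) :
    let := (Y.presheaf.germ V η hηV).hom.toAlgebra
    IsFractionRing Γ(Y, V) (Y.presheaf.stalk η) := by
  let := (Y.presheaf.germ V η hηV).hom.toAlgebra
  have h := hV.isLocalization_stalk ⟨η, hηV⟩
  have h1 : (hV.primeIdealOf ⟨η, hηV⟩).asIdeal = ⊥ := by
    rw [eq_bot_iff]
    intro a ha
    have h2 : ¬ IsUnit (Y.presheaf.germ V η hηV a) := by
      intro h3
      exact (IsLocalization.AtPrime.isUnit_to_map_iff (Y.presheaf.stalk η) _ a).1 h3 ha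
    have h4 : Y.presheaf.germ V η hηV a = 0 := by
      by_contra h5
      obtain ⟨b, hb⟩ := (isField_stalk hη).mul_inv_cancel h5
      exact h2 (IsUnit.of_mul_eq_one _ hb)
    exact (map_eq_zero_iff _ (germ_injective_of_isAffineOpen hV hηV)).1 h4
  have h2 : (hV.primeIdealOf ⟨η, hηV⟩).asIdeal.primeCompl = nonZeroDivisors Γ(Y, V) := by
    ext a
    rw [mem_nonZeroDivisors_iff_ne_zero, Ideal.mem_primeCompl_iff, h1, Ideal.mem_bot]
  unfold IsLocalization.AtPrime at h
  rw [h2] at h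
  exact h

/-- Here excellence is used: each chart is the integral closure of an excellent normal domain in a
finite extension of its fraction field. -/
theorem finite_app_and_isFractionRing_normalizationIn [IsExcellentScheme Y] [IsNormalScheme Y]
    {V : Y.Opens} (hV : IsAffineOpen V) [IsDomain Γ(Y, V)] (hηV : η ∈ V)
    (hη : closure {η} ∈ irreducibleComponents Y) (hfin : i.Finite) :
    ((normalizationInHom i).app V).hom.Finite ∧
    IsIntegrallyClosed Γ(normalizationIn i, normalizationInHom i ⁻¹ᵁ V) ∧
    ∃ c : Γ(normalizationIn i, normalizationInHom i ⁻¹ᵁ V) →+* L,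
      (∀ b, c ((normalizationInHom i).app V b) = i (Y.presheaf.germ V η hηV b)) ∧
      letI := c.toAlgebra
      IsFractionRing Γ(normalizationIn i, normalizationInHom i ⁻¹ᵁ V) L := by
  have hi := isLocalHom_of_isField (isField_stalk hη) i
  obtain ⟨c, hc, hcb, hcr⟩ := exists_normalization_chart i hi hV hηV
  have : Nonempty (normalizationInHom i ⁻¹ᵁ V) := ⟨genericPoint (normalizationIn i), by
    change normalizationInHom i _ ∈ V
    rwa [normalizationInHom_genericPoint i hi]⟩
  let : Field (Y.presheaf.stalk η) := (isField_stalk hη).toField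
  let : Algebra Γ(Y, V) (Y.presheaf.stalk η) := (Y.presheaf.germ V η hηV).hom.toAlgebra
  have : IsFractionRing Γ(Y, V) (Y.presheaf.stalk η) := isFractionRing_stalk hη hV hηV
  let : Algebra (Y.presheaf.stalk η) L := i.toAlgebra
  have : FiniteDimensional (Y.presheaf.stalk η) L := hfin
  let : Algebra Γ(Y, V) L := (i.comp (Y.presheaf.germ V η hηV).hom).toAlgebra
  have : IsScalarTower Γ(Y, V) (Y.presheaf.stalk η) L := .of_algebraMap_eq fun _ => rfl
  let : Algebra Γ(Y, V) Γ(normalizationIn i, normalizationInHom i ⁻¹ᵁ V) := ((normalizationInHom i).app V).hom.toAlgebra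
  let : Algebra Γ(normalizationIn i, normalizationInHom i ⁻¹ᵁ V) L := c.toAlgebra
  have : IsScalarTower Γ(Y, V) Γ(normalizationIn i, normalizationInHom i ⁻¹ᵁ V) L := .of_algebraMap_eq fun b => (hcb b).symm
  have : IsIntegralClosure Γ(normalizationIn i, normalizationInHom i ⁻¹ᵁ V) Γ(Y, V) L :=
    { algebraMap_injective := hc
      isIntegral_iff := fun {x} => (hcr x).symm }
  have := isIntegrallyClosed_of_isAffineOpen hV
  have hB := IsExcellentScheme.isExcellentRing V hV
  refine ⟨hB.finite_of_isIntegralClosure _ (Y.presheaf.stalk η) L _,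
    IsIntegralClosure.isIntegrallyClosed Γ(Y, V) (Y.presheaf.stalk η) L _, c, hcb, ?_⟩
  exact IsIntegralClosure.isFractionRing_of_finite_extension Γ(Y, V) (Y.presheaf.stalk η) L _

theorem finite_normal_normalizationIn [IsExcellentScheme Y] [IsNormalScheme Y]
    (hη : closure {η} ∈ irreducibleComponents Y) (hfin : i.Finite) :
    IsFinite (normalizationInHom i) ∧ IsNormalScheme (normalizationIn i) ∧
      Set.range (normalizationInHom i) = closure {η} := by
  have hi := isLocalHom_of_isField (isField_stalk hη) i
  have hgen := normalizationInHom_genericPoint i hi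
  have h (t : normalizationIn i) : ∃ V : Y.Opens, normalizationInHom i t ∈ V ∧ η ∈ V ∧
      IsAffineOpen V ∧ IsDomain Γ(Y, V) := by
    obtain ⟨V, hyV, -, hV, hd⟩ := exists_isAffineOpen_isDomain (V := ⊤)
      (Set.mem_univ (normalizationInHom i t))
    have h1 := ((genericPoint_spec (normalizationIn i)).specializes
      (Set.mem_univ t)).map (normalizationInHom i).continuous
    rw [hgen] at h1
    exact ⟨V, hyV, h1.mem_open V.isOpen hyV, hV, hd⟩
  -- The normalization morphism is integral by construction, so only finite type remains, and this
  -- is local.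
  have hF : IsFinite (normalizationInHom i) := by
    rw [IsFinite.iff_isIntegralHom_and_locallyOfFiniteType]
    refine ⟨inferInstance, ?_⟩
    rw [HasRingHomProperty.iff_exists_appLE (P := @LocallyOfFiniteType)
      (RingHom.finiteType_stableUnderComposition.stableUnderCompositionWithLocalizationAway
        RingHom.finiteType_holdsForLocalizationAway).1]
    intro t
    obtain ⟨V, htV, hηV, hV, _⟩ := h t
    refine ⟨⟨V, hV⟩, ⟨normalizationInHom i ⁻¹ᵁ V, hV.preimage _⟩, htV, le_rfl, ?_⟩
    rw [← Scheme.Hom.app_eq_appLE]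
    exact (finite_app_and_isFractionRing_normalizationIn i hV hηV hη hfin).1.finiteType
  refine ⟨hF, isNormalScheme_of_forall_isAffineOpen fun t => ?_, ?_⟩
  · obtain ⟨V, htV, hηV, hV, _⟩ := h t
    exact ⟨normalizationInHom i ⁻¹ᵁ V, htV, hV.preimage _,
      (finite_app_and_isFractionRing_normalizationIn i hV hηV hη hfin).2.1⟩
  · have h1 : IsClosed (Set.range (normalizationInHom i)) := (normalizationInHom i).isClosedMap.isClosed_range
    have h2 := ((genericPoint_spec (normalizationIn i)).image (normalizationInHom i).continuous)
    rw [hgen, Set.image_univ, h1.closure_eq] at h2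
    exact h2.symm

theorem exists_ringHom_functionField_normalizationIn [IsExcellentScheme Y] [IsNormalScheme Y]
    (hη : closure {η} ∈ irreducibleComponents Y) (hfin : i.Finite) :
    ∃ e : L →+* (normalizationIn i).functionField,
      ∀ (U : Y.Opens) (hU : η ∈ U) (hT : genericPoint (normalizationIn i) ∈ normalizationInHom i ⁻¹ᵁ U)
        (a : Γ(Y, U)), e (i (Y.presheaf.germ U η hU a)) =
          (normalizationIn i).presheaf.germ (normalizationInHom i ⁻¹ᵁ U) _ hT
            ((normalizationInHom i).app U a) := by
  have hi := isLocalHom_of_isField (isField_stalk hη) i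
  have hgen := normalizationInHom_genericPoint i hi
  obtain ⟨V, hηV, -, hV, _⟩ := exists_isAffineOpen_isDomain (V := ⊤) (Set.mem_univ η)
  obtain ⟨-, -, c, hc, hfrac⟩ := finite_app_and_isFractionRing_normalizationIn i hV hηV hη hfin
  have hgV : genericPoint (normalizationIn i) ∈ normalizationInHom i ⁻¹ᵁ V := by
    change normalizationInHom i _ ∈ V
    rwa [hgen]
  have : Nonempty (normalizationInHom i ⁻¹ᵁ V) := ⟨_, hgV⟩
  let := c.toAlgebra
  let e : L →+* (normalizationIn i).functionField := IsFractionRing.lift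
    ((normalizationIn i).germToFunctionField_injective (normalizationInHom i ⁻¹ᵁ V))
  have he (z : Γ(normalizationIn i, normalizationInHom i ⁻¹ᵁ V)) :
      e (c z) = (normalizationIn i).germToFunctionField _ z :=
    IsFractionRing.lift_algebraMap _ z
  let s : Y.presheaf.stalk η →+* (normalizationIn i).functionField :=
    (Y.presheaf.stalkSpecializes (specializes_of_eq hgen) ≫ 
      (normalizationInHom i).stalkMap (genericPoint (normalizationIn i))).hom
  have hs (U : Y.Opens) (hU : η ∈ U)
      (hT : genericPoint (normalizationIn i) ∈ normalizationInHom i ⁻¹ᵁ U) (a : Γ(Y, U)) :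
      s (Y.presheaf.germ U η hU a) = (normalizationIn i).presheaf.germ (normalizationInHom i ⁻¹ᵁ U) _ hT
            ((normalizationInHom i).app U a) := by
    change (normalizationInHom i).stalkMap _ (Y.presheaf.stalkSpecializes _ _) = _
    rw [Y.presheaf.germ_stalkSpecializes_apply, Scheme.Hom.germ_stalkMap_apply]
  -- The map `e` is built on the chart `V` only. Agreement with the canonical map on the whole
  -- stalk, checked on its subring of sections, yields compatibility for every `U`.
  have hes : e.comp i = s := by
    let := (Y.presheaf.germ V η hηV).hom.toAlgebra
    have := isFractionRing_stalk hη hV hηV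
    refine IsLocalization.ringHom_ext (nonZeroDivisors Γ(Y, V)) (RingHom.ext fun b => ?_)
    refine (congrArg e (hc b).symm).trans ?_
    rw [he]
    exact (hs V hηV hgV b).symm
  refine ⟨e, fun U hU hT a => ?_⟩
  rw [← hs U hU hT a, ← hes]
  rfl

end PlusRegular

/-! ### Finite morphisms onto an irreducible component -/

namespace PlusRegular

section

variable {S X : Scheme.{u}} [IsIntegral S] (f : S ⟶ X)

/-- The map from the local ring at the image of the generic point to the function field. -/
noncomputable def stalkToFunctionField {ξ : X} (h : f (genericPoint S) = ξ) :
    X.presheaf.stalk ξ →+* S.functionField :=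
  (X.presheaf.stalkSpecializes (specializes_of_eq h) ≫ f.stalkMap (genericPoint S)).hom

theorem stalkToFunctionField_germ {ξ : X} (h : f (genericPoint S) = ξ) {U : X.Opens} (hU : ξ ∈ U)
    [Nonempty (f ⁻¹ᵁ U)] (a : Γ(X, U)) :
    stalkToFunctionField f h (X.presheaf.germ U ξ hU a) =
      S.germToFunctionField (f ⁻¹ᵁ U) (f.app U a) := by
  change f.stalkMap _ (X.presheaf.stalkSpecializes _ _) = _
  rw [X.presheaf.germ_stalkSpecializes_apply, Scheme.Hom.germ_stalkMap_apply]

theorem closure_genericPoint_eq_range (hf : Set.range f ∈ irreducibleComponents X) :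
    closure {f (genericPoint S)} = Set.range f := by
  have h := ((genericPoint_spec S).image f.continuous)
  rw [Set.image_univ, (isClosed_of_mem_irreducibleComponents _ hf).closure_eq] at h
  exact h

variable [IsLocallyNoetherian X] [IsNormalScheme X]

/-- A function killed at `s` is killed at the generic point of `S`, where the local ring of `X` is a
field mapping to the function field of `S`. -/
theorem stalkMap_injective_of_range (hf : Set.range f ∈ irreducibleComponents X) (s : S) :
    Function.Injective (f.stalkMap s) := by
  have hξ := closure_genericPoint_eq_range f hf
  obtain ⟨U, hsU, -, hU, _⟩ := exists_isAffineOpen_isDomain (V := ⊤) (Set.mem_univ (f s))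
  refine hU.stalkMap_injective f s hsU fun a ha => ?_
  have hgs : f (genericPoint S) ⤳ f s :=
    ((genericPoint_spec S).specializes (Set.mem_univ s)).map f.continuous
  have hgU := hgs.mem_open U.isOpen hsU
  rw [Scheme.Hom.germ_stalkMap_apply, map_eq_zero_iff _ (germ_injective_of_isIntegral S s hsU)] at ha
  have h1 : f.stalkMap (genericPoint S) (X.presheaf.germ U _ hgU a) = 0 := by
    rw [Scheme.Hom.germ_stalkMap_apply, ha, map_zero]
  let := (isField_stalk (hξ.symm ▸ hf)).toField
  have h2 := (map_eq_zero_iff _ (f.stalkMap (genericPoint S)).hom.injective).1 h1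
  rw [(map_eq_zero_iff _ (germ_injective_of_isAffineOpen hU hgU)).1 h2, map_zero]

theorem app_injective_of_range (hf : Set.range f ∈ irreducibleComponents X) {U : X.Opens}
    (hU : IsAffineOpen U) [IsDomain Γ(X, U)] {s : S} (hs : f s ∈ U) :
    Function.Injective (f.app U) := by
  have h := (stalkMap_injective_of_range f hf s).comp (germ_injective_of_isAffineOpen hU hs)
  have h1 : (f.stalkMap s ∘ X.presheaf.germ U (f s) hs) =
      S.presheaf.germ (f ⁻¹ᵁ U) s hs ∘ f.app U := by
    ext a
    exact Scheme.Hom.germ_stalkMap_apply f U s hs a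
  rw [h1] at h
  exact h.of_comp

end

theorem height_primeIdealOf {X : Scheme.{u}} {U : X.Opens} (hU : IsAffineOpen U) (x : U) :
    ((hU.primeIdealOf x).asIdeal.height : WithBot ℕ∞) = Order.coheight x.1 := by
  have := hU.isLocalization_stalk x
  rw [← ringKrullDim_stalk_eq_coheight, IsLocalization.AtPrime.ringKrullDim_eq_height
    (hU.primeIdealOf x).asIdeal]

/-- On an affine chart this is equality of heights in a finite extension of a normal domain. It
makes codimension one points of the cover lie over codimension one points. -/
theorem coheight_apply_of_isFinite {S X : Scheme.{u}} [IsIntegral S] [IsLocallyNoetherian S]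
    [IsLocallyNoetherian X] [IsNormalScheme X] (f : S ⟶ X) [IsFinite f]
    (hf : Set.range f ∈ irreducibleComponents X) (s : S) :
    Order.coheight (f s) = Order.coheight s := by
  obtain ⟨U, hsU, -, hU, _⟩ := exists_isAffineOpen_isDomain (V := ⊤) (Set.mem_univ (f s))
  have hW : IsAffineOpen (f ⁻¹ᵁ U) := hU.preimage f
  have : Nonempty (f ⁻¹ᵁ U) := ⟨s, hsU⟩
  let := (f.app U).hom.toAlgebra
  have : FaithfulSMul Γ(X, U) Γ(S, f ⁻¹ᵁ U) :=
    (faithfulSMul_iff_algebraMap_injective _ _).2 (app_injective_of_range f hf hU hsU)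
  have : Module.Finite Γ(X, U) Γ(S, f ⁻¹ᵁ U) := IsFinite.finite_app f U hU
  have := isIntegrallyClosed_of_isAffineOpen hU
  have : IsNoetherianRing Γ(X, U) := IsLocallyNoetherian.component_noetherian ⟨U, hU⟩
  have : IsNoetherianRing Γ(S, f ⁻¹ᵁ U) := IsLocallyNoetherian.component_noetherian ⟨_, hW⟩
  have h1 := Ideal.height_under_eq_of_isIntegral (A := Γ(X, U)) (hW.primeIdealOf ⟨s, hsU⟩).asIdeal
  have h2 : (hW.primeIdealOf ⟨s, hsU⟩).asIdeal.under Γ(X, U) =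
      (hU.primeIdealOf ⟨f s, hsU⟩).asIdeal := by
    rw [← IsAffineOpen.comap_primeIdealOf_appLE U hU _ hW le_rfl hsU, ← Scheme.Hom.app_eq_appLE]
    rfl
  rw [h2] at h1
  have h3 := height_primeIdealOf hU ⟨f s, hsU⟩
  have h4 := height_primeIdealOf hW ⟨s, hsU⟩
  rw [h1, h4] at h3
  exact_mod_cast h3.symm

/-- Height one primes of the chart are its codimension one points, so regularity in height one
applies. -/
theorem exists_germToFunctionField_eq {S : Scheme.{u}} [IsIntegral S] [IsLocallyNoetherian S]
    [IsNormalScheme S] {W : S.Opens} (hW : IsAffineOpen W) [Nonempty W] {ψ : S.functionField}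
    (hψ : ψ ≠ 0) (h : ∀ s ∈ W, Order.coheight s = 1 → 0 ≤ Scheme.ord ψ s) :
    ∃ c, S.germToFunctionField W c = ψ := by
  have := functionField_isFractionRing_of_isAffineOpen S W hW
  have := isIntegrallyClosed_of_isAffineOpen hW
  have : IsNoetherianRing Γ(S, W) := IsLocallyNoetherian.component_noetherian ⟨W, hW⟩
  refine IsIntegrallyClosed.mem_range_algebraMap_of_height_eq_one fun p hp hp1 => ?_
  obtain ⟨s, hs⟩ := hW.primeIdealOf_surjective ⟨p, hp⟩
  have h1 := height_primeIdealOf hW s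
  rw [hs, hp1] at h1
  have h2 : Order.coheight s.1 = 1 := by exact_mod_cast h1.symm
  obtain ⟨b, hb⟩ := Scheme.exists_algebraMap_eq_of_ord_nonneg h2 hψ (h s s.2 h2)
  have := hW.isLocalization_stalk s
  rw [hs] at this
  obtain ⟨⟨a, d⟩, had⟩ := IsLocalization.surj p.primeCompl b
  refine ⟨d, d.2, a, ?_⟩
  rw [← hb, Algebra.smul_def, IsScalarTower.algebraMap_apply Γ(S, W) (S.presheaf.stalk s.1),
    ← map_mul, mul_comm, had, ← IsScalarTower.algebraMap_apply]

end PlusRegular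

/-! ### Compositum of function fields and the cover of `Y` -/

/-- Any residue field of the nonzero ring `E ⊗ F`, which is finite over `E`, serves as a compositum.
-/
theorem RingHom.Finite.exists_field_comp_eq {K E F : Type u} [Field K] [Field E] [Field F]
    (a : K →+* E) (b : K →+* F) (hb : b.Finite) :
    ∃ (L : Type u) (_ : Field L) (i : E →+* L) (l : F →+* L), i.Finite ∧ i.comp a = l.comp b := by
  let := a.toAlgebra
  let := b.toAlgebra
  have : Module.Finite K F := hb
  obtain ⟨m, hm⟩ := Ideal.exists_maximal (E ⊗[K] F)
  let := Ideal.Quotient.field m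
  have hfin : (algebraMap E (E ⊗[K] F ⧸ m)).Finite :=
    RingHom.finite_algebraMap.2 inferInstance
  refine ⟨E ⊗[K] F ⧸ m, inferInstance, algebraMap E (E ⊗[K] F ⧸ m),
    (Ideal.Quotient.mk m).comp Algebra.TensorProduct.includeRight.toRingHom, hfin, ?_⟩
  ext x
  change Ideal.Quotient.mk m (algebraMap E (E ⊗[K] F) (a x)) =
    Ideal.Quotient.mk m (Algebra.TensorProduct.includeRight (b x))
  congr 1
  have h1 : a x = algebraMap K E x := rfl
  have h2 : b x = algebraMap K F x := rfl
  rw [h1, h2, AlgHom.commutes, ← IsScalarTower.algebraMap_apply]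

namespace PlusRegular

/-- Over a chart, the function field of `S` is the localization of a finite algebra at the nonzero
elements of the base. -/
theorem finite_stalkToFunctionField {S X : Scheme.{u}} [IsIntegral S] [IsNormalScheme S]
    [IsLocallyNoetherian X] [IsNormalScheme X] (f : S ⟶ X) [IsFinite f] {ξ : X}
    (hξ : f (genericPoint S) = ξ) (hf : Set.range f ∈ irreducibleComponents X) :
    (stalkToFunctionField f hξ).Finite := by
  obtain ⟨U, hU', -, hU, _⟩ := exists_isAffineOpen_isDomain (V := ⊤) (Set.mem_univ ξ)
  have hc : closure {ξ} ∈ irreducibleComponents X := by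
    rwa [← hξ, closure_genericPoint_eq_range f hf]
  have hW : IsAffineOpen (f ⁻¹ᵁ U) := hU.preimage f
  have hgU : f (genericPoint S) ∈ U := hξ ▸ hU'
  have : Nonempty (f ⁻¹ᵁ U) := ⟨genericPoint S, hgU⟩
  let : Field (X.presheaf.stalk ξ) := (isField_stalk hc).toField
  let : Algebra (X.presheaf.stalk ξ) S.functionField := (stalkToFunctionField f hξ).toAlgebra
  let : Algebra Γ(X, U) (X.presheaf.stalk ξ) := (X.presheaf.germ U ξ hU').hom.toAlgebra
  have : IsFractionRing Γ(X, U) (X.presheaf.stalk ξ) := isFractionRing_stalk hc hU hU'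
  let : Algebra Γ(X, U) Γ(S, f ⁻¹ᵁ U) := (f.app U).hom.toAlgebra
  let : Algebra Γ(X, U) S.functionField :=
    ((stalkToFunctionField f hξ).comp (X.presheaf.germ U ξ hU').hom).toAlgebra
  have : IsScalarTower Γ(X, U) (X.presheaf.stalk ξ) S.functionField :=
    .of_algebraMap_eq fun _ => rfl
  have : IsScalarTower Γ(X, U) Γ(S, f ⁻¹ᵁ U) S.functionField :=
    .of_algebraMap_eq fun a => stalkToFunctionField_germ f hξ hU' a
  have : Module.Finite Γ(X, U) Γ(S, f ⁻¹ᵁ U) := IsFinite.finite_app f U hU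
  have := isIntegrallyClosed_of_isAffineOpen hW
  have := functionField_isFractionRing_of_isAffineOpen S _ hW
  have : FaithfulSMul Γ(X, U) Γ(S, f ⁻¹ᵁ U) :=
    (faithfulSMul_iff_algebraMap_injective _ _).2 (app_injective_of_range f hf hU hgU)
  have : IsIntegralClosure Γ(S, f ⁻¹ᵁ U) Γ(X, U) S.functionField :=
    IsIntegralClosure.of_isIntegrallyClosed _ _ _
  have : Algebra.IsAlgebraic (X.presheaf.stalk ξ) S.functionField :=
    isAlgebraic_of_isFractionRing Γ(X, U) Γ(S, f ⁻¹ᵁ U) _ _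
  have : IsLocalization (Algebra.algebraMapSubmonoid Γ(S, f ⁻¹ᵁ U) (nonZeroDivisors Γ(X, U)))
      S.functionField :=
    IsIntegralClosure.isLocalization _ (X.presheaf.stalk ξ) _ _
  exact Module.Finite.of_isLocalization Γ(X, U) Γ(S, f ⁻¹ᵁ U) (nonZeroDivisors Γ(X, U))

/-- A finite normal cover of the component of `Y` over a component of `X`, whose function field
contains that of a given finite cover of the component of `X`. -/
theorem exists_finite_normal_cover {S X Y : Scheme.{u}} [IsIntegral S] [IsNormalScheme S]
    [IsLocallyNoetherian X] [IsNormalScheme X] [IsExcellentScheme Y] [IsNormalScheme Y]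
    (f : S ⟶ X) [IsFinite f] (hf : Set.range f ∈ irreducibleComponents X) (π : Y ⟶ X)
    (hπ : ∀ U : X.Opens, IsIso (π.app U)) :
    ∃ (T : Scheme.{u}) (_ : IsIntegral T) (_ : IsLocallyNoetherian T) (_ : IsNormalScheme T)
      (g : T ⟶ Y) (_ : IsFinite g) (μ : S.functionField →+* T.functionField),
      Set.range g ∈ irreducibleComponents Y ∧ Set.range g = π ⁻¹' Set.range f ∧
      ∀ (U : X.Opens) [Nonempty (f ⁻¹ᵁ U)] [Nonempty (g ⁻¹ᵁ π ⁻¹ᵁ U)] (a : Γ(X, U)),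
        μ (S.germToFunctionField (f ⁻¹ᵁ U) (f.app U a)) =
          T.germToFunctionField (g ⁻¹ᵁ π ⁻¹ᵁ U) (g.app (π ⁻¹ᵁ U) (π.app U a)) := by
  have hr := closure_genericPoint_eq_range f hf
  obtain ⟨η, hη, hηc, hπη⟩ := exists_genericPoint_preimage π hπ (hr.symm ▸ hf)
  have hc : closure {π η} ∈ irreducibleComponents X := by rwa [hη, hr]
  let : Field (X.presheaf.stalk (π η)) := (isField_stalk hc).toField
  let : Field (Y.presheaf.stalk η) := (isField_stalk hηc).toField
  -- The field `L` receives the function fields of the component of `Y` and of `S`, compatibly over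
  -- that of `X`. The cover is the normalization of `Y` in `L`, and `μ` is `l` followed by the map
  -- of `L` to its function field.
  obtain ⟨L, _, i, l, hi, hil⟩ := RingHom.Finite.exists_field_comp_eq (π.stalkMap η).hom
    (stalkToFunctionField f hη.symm) (finite_stalkToFunctionField f hη.symm hf)
  have hloc := isLocalHom_of_isField (isField_stalk hηc) i
  have hgen := normalizationInHom_genericPoint i hloc
  obtain ⟨hg, hT, hrange⟩ := finite_normal_normalizationIn i hηc hi
  obtain ⟨e, he⟩ := exists_ringHom_functionField_normalizationIn i hηc hi
  refine ⟨normalizationIn i, inferInstance, LocallyOfFiniteType.isLocallyNoetherian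
    (normalizationInHom i), hT, normalizationInHom i, hg, e.comp l, hrange ▸ hηc, ?_, ?_⟩
  · rw [hrange, ← hπη, hr]
  · intro U _ hne a
    have hTU : genericPoint (normalizationIn i) ∈ normalizationInHom i ⁻¹ᵁ π ⁻¹ᵁ U :=
      ((genericPoint_spec (normalizationIn i)).mem_open_set_iff 
        (normalizationInHom i ⁻¹ᵁ π ⁻¹ᵁ U).isOpen).mpr (by simpa using hne)
    have hηU : η ∈ π ⁻¹ᵁ U := by
      rw [← hgen]
      exact hTU
    have h1 := he (π ⁻¹ᵁ U) hηU hTU (π.app U a)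
    refine Eq.trans ?_ h1
    rw [← stalkToFunctionField_germ f hη.symm hηU a]
    have h2 := congrArg (fun F => F (X.presheaf.germ U (π η) hηU a)) hil
    have h3 := Scheme.Hom.germ_stalkMap_apply π U η hηU a
    exact congrArg e (h2.symm.trans (congrArg i h3))

end PlusRegular

/-! ### Comparison of divisorial sections -/

namespace PlusRegular

/-- The ramification index of `𝒪_{X, f s} → 𝒪_{S, s}`. -/
noncomputable def ramificationIndex {S X : Scheme.{u}} (f : S ⟶ X) (s : S) : ℕ :=
  (Module.length (S.presheaf.stalk s) (S.presheaf.stalk s ⧸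
    (IsLocalRing.maximalIdeal (X.presheaf.stalk (f s))).map (f.stalkMap s).hom)).toNat

theorem ord_germToFunctionField_app {S X : Scheme.{u}} [IsIntegral S] [IsLocallyNoetherian S]
    [IsLocallyNoetherian X] [IsNormalScheme X] (f : S ⟶ X) [IsFinite f]
    (hf : Set.range f ∈ irreducibleComponents X) {U : X.Opens} [Nonempty (f ⁻¹ᵁ U)] (h : Γ(X, U))
    {s : S} (hs : Order.coheight s = 1) (hsU : f s ∈ U) (hh : X.presheaf.germ U (f s) hsU h ≠ 0) :
    Scheme.ord (S.germToFunctionField (f ⁻¹ᵁ U) (f.app U h)) s =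
      (ramificationIndex f s * (Ring.ord (X.presheaf.stalk (f s))
        (X.presheaf.germ U (f s) hsU h)).toNat : ℕ) := by
  have hinj := stalkMap_injective_of_range f hf s
  have := IsNormalScheme.isDomain (f s)
  have := isDiscreteValuationRing_stalk X ((coheight_apply_of_isFinite f hf s).trans hs)
  have h1 := Scheme.Hom.germ_stalkMap_apply f U s hsU h
  have h2 : S.presheaf.germ (f ⁻¹ᵁ U) s hsU (f.app U h) ≠ 0 := by
    rw [← h1]
    exact (map_ne_zero_iff _ hinj).2 hh
  rw [Scheme.ord_germToFunctionField hs hsU h2, ← h1]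
  exact congrArg Nat.cast (Ring.toNat_ord_map (f.stalkMap s).hom hinj hh)

/-- The section `a` has nonzero germs and `D ≤ div a` on `U`. -/
structure IsEffectiveBound {X : Scheme.{u}} (D : AlgebraicCycle X ℤ) (U : X.Opens)
    (a : Γ(X, U)) : Prop where
  germ_ne_zero : ∀ (x : X) (hx : x ∈ U), X.presheaf.germ U x hx a ≠ 0
  le_ord : ∀ (x : X) (hx : x ∈ U), Order.coheight x = 1 →
    D x ≤ ((Ring.ord (X.presheaf.stalk x) (X.presheaf.germ U x hx a)).toNat : ℤ)

theorem IsEffectiveBound.restrict {X : Scheme.{u}} {D : AlgebraicCycle X ℤ} {U V : X.Opens}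
    {a : Γ(X, U)} (ha : IsEffectiveBound D U a) (h : V ≤ U) :
    IsEffectiveBound D V (X.presheaf.map (homOfLE h).op a) where
  germ_ne_zero x hx := by
    rw [TopCat.Presheaf.germ_res_apply]
    exact ha.germ_ne_zero x (h hx)
  le_ord x hx hx1 := by
    rw [TopCat.Presheaf.germ_res_apply]
    exact ha.le_ord x (h hx) hx1

theorem IsLocalEquation.restrict {X : Scheme.{u}} {Δ : AlgebraicCycle X ℚ} {m : ℕ}
    {U V : X.Opens} {a : Γ(X, U)} (ha : IsLocalEquation Δ m U a) (h : V ≤ U) :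
    IsLocalEquation Δ m V (X.presheaf.map (homOfLE h).op a) where
  germ_ne_zero x hx := by
    rw [TopCat.Presheaf.germ_res_apply]
    exact ha.germ_ne_zero x (h hx)
  eq_ord x hx hx1 := by
    rw [TopCat.Presheaf.germ_res_apply]
    exact ha.eq_ord x (h hx) hx1

/-- A divisor `E` on `Y` such that near every point `D ≤ div a` for a section `a` whose pullback
has the same order as `E`. -/
def IsPullbackBound {X Y : Scheme.{u}} (π : Y ⟶ X) (D : AlgebraicCycle X ℤ)
    (E : AlgebraicCycle Y ℤ) : Prop :=
  ∀ y : Y, Order.coheight y = 1 → ∃ (U : X.Opens) (a : Γ(X, U)) (hy : π y ∈ U),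
    IsEffectiveBound D U a ∧ E y = ((Ring.ord (Y.presheaf.stalk y)
      (π.stalkMap y (X.presheaf.germ U (π y) hy a))).toNat : ℤ)

/-- Arithmetic at a codimension one point of `S`: `o` is the order of a section, `r` the
ramification index, `δ` and `d` the multiplicities of `Δ` and `D`, `p` and `q` the orders downstairs
of an equation of `mΔ` and of a section bounding `D`. Multiplication by `m N` clears the
denominators of `Δ` and `ε`. -/
theorem nonneg_of_floor_nonneg {m N k r p q : ℕ} {o d : ℤ} {δ ε : ℚ}
    (hk : (k : ℚ) = m * N * ε) (h : 0 ≤ o + ⌊r * (δ + ε * d)⌋) (hp : m * δ = p) (hq : d ≤ q) :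
    0 ≤ (m * N : ℕ) * o + N * (r * p : ℕ) + k * (r * q : ℕ) := by
  have h1 : -(o : ℚ) ≤ r * (δ + ε * d) := by
    rw [← Int.cast_neg, ← Int.le_floor]
    omega
  have h2 : (d : ℚ) ≤ q := by exact_mod_cast hq
  have h3 : (0 : ℚ) ≤ (m * N : ℕ) * o + N * (r * p : ℕ) + k * (r * q : ℕ) := by
    have h4 : (m * N : ℚ) * -o ≤ m * N * (r * (δ + ε * d)) :=
      mul_le_mul_of_nonneg_left h1 (by positivity)
    have h5 : (k * r : ℚ) * d ≤ k * r * q := mul_le_mul_of_nonneg_left h2 (by positivity)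
    push_cast
    rw [← hp]
    rw [hk] at h5 ⊢
    linarith
  exact_mod_cast h3

/-- The reverse passage, at a point of `T`: here `d` is exactly the order of the pulled back
bounding section. Dividing by `m N` and using that `o` is an integer recovers the floor. -/
theorem floor_nonneg_of_nonneg {m N k r p : ℕ} {o d : ℤ} {δ ε : ℚ} (hm : 0 < m) (hN : 0 < N)
    (hk : (k : ℚ) = m * N * ε) (hp : m * δ = p)
    (h : 0 ≤ (m * N : ℕ) * o + N * (r * p : ℕ) + k * (r * d)) :
    0 ≤ o + ⌊r * (δ + ε * d)⌋ := by
  have h1 : (0 : ℚ) ≤ (m * N : ℕ) * o + N * (r * p : ℕ) + k * (r * d) := by exact_mod_cast h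
  push_cast at h1
  rw [← hp, hk] at h1
  have hm' : (0 : ℚ) < m := by exact_mod_cast hm
  have hN' : (0 : ℚ) < N := by exact_mod_cast hN
  have h2 : (0 : ℚ) ≤ o + r * (δ + ε * d) := by
    refine nonneg_of_mul_nonneg_right (a := (m * N : ℚ)) ?_ (by positivity)
    linarith
  have h3 : -o ≤ ⌊r * (δ + ε * d)⌋ := by
    rw [Int.le_floor]
    push_cast
    linarith
  omega

theorem ord_nonneg_of_isIntegral {T : Scheme.{u}} [IsIntegral T] [IsLocallyNoetherian T]
    [IsNormalScheme T] {W : T.Opens} [Nonempty W] {t : T} (ht : t ∈ W) {z : T.functionField}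
    (hz : _root_.IsIntegral Γ(T, W) z) : 0 ≤ Scheme.ord z t := by
  by_cases ht1 : Order.coheight t = 1
  swap
  · rw [Scheme.ord_eq_zero_of_coheight_neq_one ht1]
  by_cases hz0 : z = 0
  · rw [hz0, Scheme.ord_zero]
    rfl
  let := (T.presheaf.germ W t ht).hom.toAlgebra
  have : IsScalarTower Γ(T, W) (T.presheaf.stalk t) T.functionField :=
    functionField_isScalarTower T W ⟨t, ht⟩
  have := IsNormalScheme.isIntegrallyClosed t
  obtain ⟨b, rfl⟩ := IsIntegrallyClosed.isIntegral_iff.1 (hz.tower_top (A := T.presheaf.stalk t))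
  rw [Scheme.ord_algebraMap ht1 (fun h => hz0 (by rw [h, map_zero]))]
  exact Nat.cast_nonneg _

/-- A codimension one point of `T` may lie over a point of larger codimension of `X`, so its order
is not determined by orders on `S`. The comparison goes through one regular function on `S`, whose
integrality over `X` is preserved by `μ`; no morphism from `T` to `S` is needed. -/
theorem mem_divisorialSections_of_cover {S X Y T : Scheme.{u}} [IsIntegral S]
    [IsLocallyNoetherian S] [IsNormalScheme S] [IsLocallyNoetherian X] [IsNormalScheme X]
    [IsLocallyNoetherian Y] [IsNormalScheme Y] [IsIntegral T] [IsLocallyNoetherian T]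
    [IsNormalScheme T] (f : S ⟶ X) [IsFinite f] (hf : Set.range f ∈ irreducibleComponents X)
    (π : Y ⟶ X) (hπ : ∀ U : X.Opens, IsIso (π.app U)) (g : T ⟶ Y) [IsFinite g]
    (hg : Set.range g ∈ irreducibleComponents Y) (hfg : Set.range g ⊆ π ⁻¹' Set.range f)
    (μ : S.functionField →+* T.functionField)
    (hμ : ∀ (U : X.Opens) [Nonempty (f ⁻¹ᵁ U)] [Nonempty (g ⁻¹ᵁ π ⁻¹ᵁ U)] (a : Γ(X, U)),
      μ (S.germToFunctionField (f ⁻¹ᵁ U) (f.app U a)) =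
        T.germToFunctionField (g ⁻¹ᵁ π ⁻¹ᵁ U) (g.app (π ⁻¹ᵁ U) (π.app U a)))
    {Δ : AlgebraicCycle X ℚ} (hΔ : IsEffectiveQCartier Δ) {ΔY : AlgebraicCycle Y ℚ}
    (hΔY : IsQCartierPullback π Δ ΔY) {D : AlgebraicCycle X ℤ} {E : AlgebraicCycle Y ℤ}
    (hE : IsPullbackBound π D E) {ε : ℚ} (hε : 0 < ε) (U : X.Opens) [Nonempty (f ⁻¹ᵁ U)]
    [Nonempty (g ⁻¹ᵁ π ⁻¹ᵁ U)] {φ : S.functionField}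
    (hφ : φ ∈ divisorialSections S (fun s => ⌊pullbackMult f (perturb Δ ε D) s⌋) (f ⁻¹ᵁ U)) :
    μ φ ∈ divisorialSections T (fun t => ⌊pullbackMult g (perturb ΔY ε E) t⌋)
      (g ⁻¹ᵁ π ⁻¹ᵁ U) := by
  intro hμφ t ht ht1
  have hφ0 : φ ≠ 0 := fun h => hμφ (by rw [h, map_zero])
  have hy1 : Order.coheight (g t) = 1 := (coheight_apply_of_isFinite g hg t).trans ht1
  obtain ⟨m, hm, hloc⟩ := hΔ.exists_isLocalEquation
  obtain ⟨U₁, h, hxU₁, hh⟩ := hloc (π (g t))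
  obtain ⟨U₂, a, hxU₂, ha, hEy⟩ := hE (g t) hy1
  obtain ⟨V, hxV, hVU, hV, _⟩ := exists_isAffineOpen_isDomain (V := U ⊓ U₁ ⊓ U₂)
    (x := π (g t)) ⟨⟨ht, hxU₁⟩, hxU₂⟩
  rw [← TopCat.Presheaf.germ_res_apply X.presheaf (homOfLE (hVU.trans inf_le_right)) _ hxV a]
    at hEy
  replace hh := hh.restrict (hVU.trans (inf_le_left.trans inf_le_right))
  replace ha := ha.restrict (hVU.trans inf_le_right)
  generalize X.presheaf.map (homOfLE (hVU.trans (inf_le_left.trans inf_le_right))).op h = h at hh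
  generalize X.presheaf.map (homOfLE (hVU.trans inf_le_right)).op a = a at ha hEy
  have hVU' : V ≤ U := hVU.trans (inf_le_left.trans inf_le_left)
  have hneT : Nonempty (g ⁻¹ᵁ π ⁻¹ᵁ V) := ⟨t, hxV⟩
  have hneS : Nonempty (f ⁻¹ᵁ V) := by
    obtain ⟨s, hs⟩ := hfg ⟨t, rfl⟩
    exact ⟨s, by rw [Scheme.Hom.mem_preimage, hs]; exact hxV⟩
  set H := S.germToFunctionField (f ⁻¹ᵁ V) (f.app V h) with hH
  set A := S.germToFunctionField (f ⁻¹ᵁ V) (f.app V a) with hA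
  have happ : Function.Injective (f.app V) := by
    obtain ⟨s, hs⟩ := hneS
    exact app_injective_of_range f hf hV hs
  have hne {b : Γ(X, V)} (hb : ∀ (x : X) (hx : x ∈ V), X.presheaf.germ V x hx b ≠ 0) :
      S.germToFunctionField (f ⁻¹ᵁ V) (f.app V b) ≠ 0 := by
    rw [map_ne_zero_iff _ (S.germToFunctionField_injective _), map_ne_zero_iff _ happ]
    rintro rfl
    exact hb _ hxV (map_zero _)
  have hH0 : H ≠ 0 := hne hh.germ_ne_zero
  have hA0 : A ≠ 0 := hne ha.germ_ne_zero
  -- With `N` the denominator of `ε` and `k = m N ε`, all exponents below are integers.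
  set N := ε.den
  set k := m * ε.num.toNat
  have hk : (k : ℚ) = m * N * ε := by
    have h1 : ((ε.num.toNat : ℤ) : ℚ) = (ε.num : ℚ) := by
      rw [Int.toNat_of_nonneg (Rat.num_nonneg.2 hε.le)]
    push_cast [k]
    rw [← Rat.mul_den_eq_num, Int.cast_natCast] at h1
    rw [h1]
    ring
  have hN : 0 < N := ε.den_pos
  -- On `f⁻¹ V` the divisor of `ψ` is `m N (div φ + f^*Δ) + k f^* div a`, at least `m N (div φ +
  -- f^*(Δ + εD))` and so effective.
  set ψ := φ ^ (m * N) * H ^ N * A ^ k with hψ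
  have hψ0 : ψ ≠ 0 := mul_ne_zero (mul_ne_zero (pow_ne_zero _ hφ0) (pow_ne_zero _ hH0))
    (pow_ne_zero _ hA0)
  obtain ⟨c, hc⟩ : ∃ c, S.germToFunctionField (f ⁻¹ᵁ V) c = ψ := by
    refine exists_germToFunctionField_eq (hV.preimage f) hψ0 fun s hs hs1 => ?_
    have h1 := hφ hφ0 s (hVU' hs) hs1
    have hx1 : Order.coheight (f s) = 1 := (coheight_apply_of_isFinite f hf s).trans hs1
    have h2 : Scheme.ord H s = _ :=
      ord_germToFunctionField_app f hf h hs1 hs (hh.germ_ne_zero _ hs)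
    have h3 : Scheme.ord A s = _ :=
      ord_germToFunctionField_app f hf a hs1 hs (ha.germ_ne_zero _ hs)
    have h4 := hh.eq_ord (f s) hs hx1
    have h5 := ha.le_ord (f s) hs hx1
    rw [hψ, Scheme.ord_mul (mul_ne_zero (pow_ne_zero _ hφ0) (pow_ne_zero _ hH0))
      (pow_ne_zero _ hA0), Scheme.ord_mul (pow_ne_zero _ hφ0) (pow_ne_zero _ hH0),
      Scheme.ord_pow hφ0, Scheme.ord_pow hH0, Scheme.ord_pow hA0, h2, h3]
    exact nonneg_of_floor_nonneg hk h1 h4 h5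
  have key {b : Γ(X, V)} (hb : X.presheaf.germ V (π (g t)) hxV b ≠ 0) :
      Scheme.ord (μ (S.germToFunctionField (f ⁻¹ᵁ V) (f.app V b))) t =
        (ramificationIndex g t * (Ring.ord (Y.presheaf.stalk (g t))
          (π.stalkMap (g t) (X.presheaf.germ V (π (g t)) hxV b))).toNat : ℕ) := by
    have h1 := Scheme.Hom.germ_stalkMap_apply π V (g t) hxV b
    rw [hμ, h1]
    refine ord_germToFunctionField_app g hg (π.app V b) ht1 hxV ?_
    rw [← h1]
    exact (map_ne_zero_iff _ (stalkMap_injective π hπ _)).2 hb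
  have h1 := key (hh.germ_ne_zero _ hxV)
  have h2 := key (ha.germ_ne_zero _ hxV)
  have h3 := hΔY.eq_ord (g t) hy1 m hm V h hxV hh
  -- A monic equation of `c` over `Γ(X, V)` is carried by `μ` to one of `μ ψ` over the sections of
  -- `T`, and `T` is normal.
  have h4 : 0 ≤ Scheme.ord (μ ψ) t := by
    refine ord_nonneg_of_isIntegral (W := g ⁻¹ᵁ π ⁻¹ᵁ V) hxV ?_
    obtain ⟨p, hp, hp0⟩ := (IsFinite.finite_app f V hV).to_isIntegral c
    have h5 : (μ.comp (S.germToFunctionField (f ⁻¹ᵁ V)).hom).comp (f.app V).hom =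
        (algebraMap Γ(T, g ⁻¹ᵁ π ⁻¹ᵁ V) T.functionField).comp
          ((g.app (π ⁻¹ᵁ V)).hom.comp (π.app V).hom) :=
      RingHom.ext fun b => hμ V b
    refine ⟨p.map ((g.app (π ⁻¹ᵁ V)).hom.comp (π.app V).hom), hp.map _, ?_⟩
    rw [Polynomial.eval₂_map, ← h5, ← hc]
    refine (Polynomial.hom_eval₂ p (f.app V).hom
      (μ.comp (S.germToFunctionField (f ⁻¹ᵁ V)).hom) c).symm.trans ?_
    rw [hp0, map_zero]
  have hμH : μ H ≠ 0 := (map_ne_zero_iff μ μ.injective).2 hH0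
  have hμA : μ A ≠ 0 := (map_ne_zero_iff μ μ.injective).2 hA0
  rw [hψ, map_mul, map_mul, map_pow, map_pow, map_pow,
    Scheme.ord_mul (mul_ne_zero (pow_ne_zero _ hμφ) (pow_ne_zero _ hμH)) (pow_ne_zero _ hμA),
    Scheme.ord_mul (pow_ne_zero _ hμφ) (pow_ne_zero _ hμH),
    Scheme.ord_pow hμφ, Scheme.ord_pow hμH, Scheme.ord_pow hμA, h1, h2,
    Nat.cast_mul _ (Ring.ord _ (π.stalkMap (g t) (X.presheaf.germ V (π (g t)) hxV a))).toNat, ← hEy] at h4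
  refine floor_nonneg_of_nonneg hm hN hk h3 ?_
  exact h4

end PlusRegular

/-! ### A divisor on `Y` dominating the pullback of a divisor on `X` -/

namespace PlusRegular

theorem germ_isUnit_iff {X : Scheme.{u}} {U : X.Opens} (hU : IsAffineOpen U) (x : U) (a : Γ(X, U)) :
    IsUnit (X.presheaf.germ U x x.2 a) ↔ a ∉ (hU.primeIdealOf x).asIdeal := by
  have := hU.isLocalization_stalk x
  exact IsLocalization.AtPrime.isUnit_to_map_iff (X.presheaf.stalk x.1) _ a

theorem toNat_ord_le_of_dvd {R : Type*} [CommRing R] [IsDomain R] [IsDiscreteValuationRing R]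
    {a b : R} (hb : b ≠ 0) (h : a ∣ b) : (Ring.ord R a).toNat ≤ (Ring.ord R b).toNat :=
  ENat.toNat_le_toNat (Ring.ord_le_ord_of_dvd h) (Ring.ord_ne_top (by simpa using hb))

theorem le_toNat_ord_pow {R : Type*} [CommRing R] [IsDomain R] [IsDiscreteValuationRing R]
    {b : R} (hb : b ≠ 0) (h : ¬ IsUnit b) (n : ℕ) : n ≤ (Ring.ord R (b ^ n)).toNat := by
  rw [Ring.ord_pow (by simpa using hb)]
  have h1 : (Ring.ord R b).toNat ≠ 0 := by
    rw [Ne, ENat.toNat_eq_zero, not_or, Ring.ord_eq_addVal]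
    refine ⟨?_, ?_⟩
    · rwa [IsDiscreteValuationRing.addVal_eq_zero_iff]
    · rwa [IsDiscreteValuationRing.addVal_eq_top_iff]
  simpa using Nat.le_mul_of_pos_right n (Nat.pos_of_ne_zero h1)

/-- On a small affine open set only finitely many points carry `D`. A nonzero function vanishing at
each, raised to the multiplicity of `D`, contributes a factor; no Cartier condition on `D` is
involved. -/
theorem exists_isEffectiveBound {X : Scheme.{u}} [IsLocallyNoetherian X] [IsNormalScheme X]
    (D : AlgebraicCycle X ℤ) (x : X) :
    ∃ (U : X.Opens) (a : Γ(X, U)), x ∈ U ∧ IsEffectiveBound D U a := by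
  classical
  obtain ⟨s, hs, hfin⟩ := D.supportLocallyFiniteWithinDomain x (Set.mem_univ x)
  obtain ⟨s', hs's, hs'o, hxs'⟩ := mem_nhds_iff.1 hs
  obtain ⟨V, hxV, hVs, hV, _⟩ := exists_isAffineOpen_isDomain (V := ⟨s', hs'o⟩) hxs'
  have hb (z : X) : ∃ b : Γ(X, V), b ≠ 0 ∧ ∀ hz : z ∈ V, Order.coheight z = 1 →
      ¬ IsUnit (X.presheaf.germ V z hz b) := by
    by_cases hz : z ∈ V ∧ Order.coheight z = 1
    · have h1 := height_primeIdealOf hV ⟨z, hz.1⟩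
      have h2 : (hV.primeIdealOf ⟨z, hz.1⟩).asIdeal ≠ ⊥ := by
        intro h
        rw [h, Ideal.height_bot, hz.2] at h1
        exact zero_ne_one h1
      obtain ⟨b, hb, hb0⟩ := Submodule.exists_mem_ne_zero_of_ne_bot h2
      exact ⟨b, hb0, fun _ _ h => (germ_isUnit_iff hV ⟨z, hz.1⟩ b).1 h hb⟩
    · exact ⟨1, one_ne_zero, fun h h' => (hz ⟨h, h'⟩).elim⟩
  choose b hb0 hb using hb
  let a : Γ(X, V) := ∏ z ∈ hfin.toFinset, b z ^ (D z).toNat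
  have ha : a ≠ 0 := Finset.prod_ne_zero_iff.2 fun z _ => pow_ne_zero _ (hb0 z)
  have hgerm {c : Γ(X, V)} (hc : c ≠ 0) (z : X) (hz : z ∈ V) : X.presheaf.germ V z hz c ≠ 0 :=
    (map_ne_zero_iff _ (germ_injective_of_isAffineOpen hV hz)).2 hc
  refine ⟨V, a, hxV, hgerm ha, fun z hz hz1 => ?_⟩
  have := IsNormalScheme.isDomain z
  have := isDiscreteValuationRing_stalk X hz1
  by_cases hD : D z = 0
  · rw [hD]
    exact Nat.cast_nonneg _
  have hzF : z ∈ hfin.toFinset := hfin.mem_toFinset.2 ⟨hs's (hVs hz), hD⟩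
  have h1 : b z ^ (D z).toNat ∣ a := Finset.dvd_prod_of_mem (fun z => b z ^ (D z).toNat) hzF
  have h2 := map_dvd (X.presheaf.germ V z hz).hom h1
  rw [map_pow] at h2
  have h3 := (le_toNat_ord_pow (hgerm (hb0 z) z hz) (hb z hz hz1) (D z).toNat).trans
    (toNat_ord_le_of_dvd (hgerm ha z hz) h2)
  exact (Int.self_le_toNat _).trans (by exact_mod_cast h3)

/-- These points correspond to height one primes containing `c ≠ 0`, which are minimal over `c`. -/
theorem finite_coheight_one_not_isUnit {Y : Scheme.{u}} [IsLocallyNoetherian Y] {W : Y.Opens}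
    (hW : IsAffineOpen W) [IsDomain Γ(Y, W)] {c : Γ(Y, W)} (hc : c ≠ 0) :
    {y | Order.coheight y = 1 ∧ ∃ hy : y ∈ W, ¬ IsUnit (Y.presheaf.germ W y hy c)}.Finite := by
  have : IsNoetherianRing Γ(Y, W) := IsLocallyNoetherian.component_noetherian ⟨W, hW⟩
  refine (((Ideal.finite_minimalPrimes_of_isNoetherianRing _ (Ideal.span {c})).preimage
    (f := fun p : PrimeSpectrum Γ(Y, W) => p.asIdeal)
    (fun p _ q _ h => PrimeSpectrum.ext h)).image hW.fromSpec).subset ?_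
  rintro y ⟨hy1, hy, hyc⟩
  refine ⟨hW.primeIdealOf ⟨y, hy⟩, ?_, hW.fromSpec_primeIdealOf ⟨y, hy⟩⟩
  have h1 := height_primeIdealOf hW ⟨y, hy⟩
  rw [hy1] at h1
  have h2 : (hW.primeIdealOf ⟨y, hy⟩).asIdeal.height = 1 := by exact_mod_cast h1
  have h3 : c ∈ (hW.primeIdealOf ⟨y, hy⟩).asIdeal :=
    not_not.1 fun h => hyc ((germ_isUnit_iff hW ⟨y, hy⟩ c).2 h)
  refine ⟨⟨inferInstance, (Ideal.span_singleton_le_iff_mem _).2 h3⟩, ?_⟩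
  rintro q ⟨hq, hcq⟩ hqp
  by_contra h
  have h4 : q < (hW.primeIdealOf ⟨y, hy⟩).asIdeal := lt_of_le_not_ge hqp h
  have h5 := Ideal.height_strict_mono_of_isPrime h4
  rw [h2, Order.lt_one_iff, Ideal.height_eq_zero_iff_eq_bot] at h5
  rw [h5, le_bot_iff, Ideal.span_singleton_eq_bot] at hcq
  exact hc hcq

section

variable {X Y : Scheme.{u}} (π : Y ⟶ X) (D : AlgebraicCycle X ℤ)

/-- The orders at `y` of the pullbacks of the sections `a` near `π y` with `D ≤ div a`. -/
def pullbackBounds (y : Y) : Set ℕ :=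
  {n | ∃ (U : X.Opens) (a : Γ(X, U)) (hy : π y ∈ U), IsEffectiveBound D U a ∧
    n = (Ring.ord (Y.presheaf.stalk y) (π.stalkMap y (X.presheaf.germ U (π y) hy a))).toNat}

variable [IsLocallyNoetherian X] [IsNormalScheme X]

theorem pullbackBounds_nonempty (y : Y) : (pullbackBounds π D y).Nonempty := by
  obtain ⟨U, a, hy, ha⟩ := exists_isEffectiveBound D (π y)
  exact ⟨_, U, a, hy, ha, rfl⟩

variable [IsLocallyNoetherian Y] [IsNormalScheme Y]

/-- A Weil divisor has no pullback, and the local bounding sections need not glue. Taking at each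
`y` the least order among all of them makes a choice independent of any cover, and the minimum is
attained. -/
theorem exists_isPullbackBound (hπ : ∀ U : X.Opens, IsIso (π.app U)) :
    ∃ E : AlgebraicCycle Y ℤ, IsDivisor E ∧ 0 ≤ E ∧ IsPullbackBound π D E := by
  classical
  let e (y : Y) : ℤ := if Order.coheight y = 1 then (sInf (pullbackBounds π D y) : ℕ) else 0
  have he0 (y : Y) (h : e y ≠ 0) : Order.coheight y = 1 := by
    by_contra h1
    exact h (if_neg h1)
  refine ⟨⟨e, Set.subset_univ _, fun z _ => ?_⟩, he0, ?_, fun y hy => ?_⟩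
  · obtain ⟨U, a, hzU, ha⟩ := exists_isEffectiveBound D (π z)
    obtain ⟨W, hzW, hWU, hW, _⟩ := exists_isAffineOpen_isDomain (V := π ⁻¹ᵁ U) hzU
    let c : Γ(Y, W) := Y.presheaf.map (homOfLE hWU).op (π.app U a)
    have hc (y : Y) (hy : y ∈ W) : Y.presheaf.germ W y hy c =
        π.stalkMap y (X.presheaf.germ U (π y) (hWU hy) a) := by
      rw [TopCat.Presheaf.germ_res_apply]
      exact (Scheme.Hom.germ_stalkMap_apply π U y (hWU hy) a).symm
    have hc0 : c ≠ 0 := by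
      intro h
      have h1 := hc z hzW
      rw [h, map_zero] at h1
      exact (map_ne_zero_iff _ (stalkMap_injective π hπ z)).2 (ha.germ_ne_zero _ hzU) h1.symm
    refine ⟨W, W.isOpen.mem_nhds hzW, (finite_coheight_one_not_isUnit hW hc0).subset ?_⟩
    rintro y ⟨hyW, hy⟩
    refine ⟨he0 y hy, hyW, fun hu => hy ?_⟩
    -- One section `a` controls a whole neighbourhood: where its pullback is a unit, the minimum is
    -- zero. Its nonunit points of codimension one are finite in number.
    have h1 : (0 : ℕ) ∈ pullbackBounds π D y :=
      ⟨U, a, hWU hyW, ha, by rw [← hc y hyW, Ring.ord_of_isUnit hu]; rfl⟩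
    change (if Order.coheight y = 1 then ((sInf (pullbackBounds π D y) : ℕ) : ℤ) else 0) = 0
    rw [if_pos (he0 y hy), Nat.sInf_eq_zero.2 (Or.inl h1)]
    rfl
  · rw [Function.locallyFinsuppWithin.le_def]
    intro y
    change 0 ≤ e y
    simp only [e]
    split_ifs
    · exact Nat.cast_nonneg _
    · exact le_rfl
  · obtain ⟨U, a, hyU, ha, h⟩ := Nat.sInf_mem (pullbackBounds_nonempty π D y)
    refine ⟨U, a, hyU, ha, ?_⟩
    rw [← h]
    exact if_pos hy

end

end PlusRegular

/-! ### Descending splittings -/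

namespace PlusRegular

theorem one_mem_divisorialSections {S X : Scheme.{u}} [IsIntegral S] [IsLocallyNoetherian S]
    [IsNormalScheme S] (f : S ⟶ X) {Δ : AlgebraicCycle X ℚ} (hΔ : ∀ x, 0 ≤ Δ x) (V : S.Opens)
    [Nonempty V] :
    (1 : S.functionField) ∈ divisorialSections S (fun s => ⌊pullbackMult f Δ s⌋) V := by
  intro _ s _ _
  have h1 : Scheme.ord (1 : S.functionField) s = 0 := by
    have h := Scheme.ord_pow (x := s) (one_ne_zero (α := S.functionField)) 0
    simpa using h
  rw [h1, zero_add]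
  exact Int.floor_nonneg.2 (mul_nonneg (Nat.cast_nonneg _) (hΔ _))

/-- The splitting is the composite of `μ`, the splitting `σ` over the preimage, and the inverse of
`𝒪_X → π_* 𝒪_Y`. Each identity is checked after the injective map `π.app`. -/
theorem nonempty_splitting_of_cover {S X Y T : Scheme.{u}} [IsIntegral S]
    [IsLocallyNoetherian S] [IsNormalScheme S] [IsIntegral T] [IsLocallyNoetherian T]
    [IsNormalScheme T] (f : S ⟶ X) (π : Y ⟶ X) (hπ : ∀ U : X.Opens, IsIso (π.app U)) (g : T ⟶ Y)
    (hf : IsOpen (Set.range f)) (hfg : Set.range g = π ⁻¹' Set.range f) (μ : S.functionField →+* T.functionField)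
    (hμ : ∀ (U : X.Opens) [Nonempty (f ⁻¹ᵁ U)] [Nonempty (g ⁻¹ᵁ π ⁻¹ᵁ U)] (a : Γ(X, U)),
      μ (S.germToFunctionField (f ⁻¹ᵁ U) (f.app U a)) =
        T.germToFunctionField (g ⁻¹ᵁ π ⁻¹ᵁ U) (g.app (π ⁻¹ᵁ U) (π.app U a)))
    {Δ : AlgebraicCycle X ℚ} {ΔY : AlgebraicCycle Y ℚ} (hΔ : ∀ x, 0 ≤ Δ x)
    (hmem : ∀ (U : X.Opens) [Nonempty (f ⁻¹ᵁ U)] [Nonempty (g ⁻¹ᵁ π ⁻¹ᵁ U)]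
      (φ : S.functionField), φ ∈ divisorialSections S (fun s => ⌊pullbackMult f Δ s⌋) (f ⁻¹ᵁ U) →
        μ φ ∈ divisorialSections T (fun t => ⌊pullbackMult g ΔY t⌋) (g ⁻¹ᵁ π ⁻¹ᵁ U))
    (σ : Splitting g ΔY) : Nonempty (Splitting f Δ) := by
  -- The part of `U` inside the open component is nonempty, so it meets the image of `π`, and the
  -- points above it lie in the image of `g`.
  have hne (U : X.Opens) [h : Nonempty (f ⁻¹ᵁ U)] : Nonempty (g ⁻¹ᵁ π ⁻¹ᵁ U) := by
    obtain ⟨s, hs⟩ := h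
    obtain ⟨y, hyU, hy⟩ := exists_mem_preimage π hπ (U := U ⊓ ⟨Set.range f, hf⟩) ⟨hs, s, rfl⟩
    obtain ⟨t, rfl⟩ := hfg.ge hy
    exact ⟨t, hyU⟩
  have hsub (U : X.Opens) (hU : (U : Set X) ⊆ Set.range f) :
      ((π ⁻¹ᵁ U : Y.Opens) : Set Y) ⊆ Set.range g := by
    rw [hfg]
    exact Set.preimage_mono hU
  let ι (U : X.Opens) [Nonempty (f ⁻¹ᵁ U)] :
      divisorialSections S (fun s => ⌊pullbackMult f Δ s⌋) (f ⁻¹ᵁ U) →+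
        have := hne U
        divisorialSections T (fun t => ⌊pullbackMult g ΔY t⌋) (g ⁻¹ᵁ π ⁻¹ᵁ U) :=
    have := hne U
    { toFun := fun φ => ⟨μ φ, hmem U φ φ.2⟩
      map_zero' := Subtype.ext (map_zero μ)
      map_add' := fun φ ψ => Subtype.ext (map_add μ φ.1 ψ.1) }
  have hinv (U : X.Opens) (z : Γ(Y, π ⁻¹ᵁ U)) :
      have := hπ U
      π.app U (inv (π.app U) z) = z := by
    have := hπ U
    exact ConcreteCategory.congr_hom (IsIso.inv_hom_id (π.app U)) z
  refine ⟨{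
    toHom := fun U _ hU =>
      have := hne U
      have := hπ U
      ((inv (π.app U)).hom : _ →+ _).comp ((σ.toHom (π ⁻¹ᵁ U) (hsub U hU)).comp (ι U))
    map_smul := ?_
    map_restrict := ?_
    map_one := ?_ }⟩
  · intro U _ hU a φ
    have := hne U
    refine (app_bijective π hπ U).1 ((hinv U _).trans ?_)
    rw [map_mul]
    refine Eq.trans ?_ (congrArg (π.app U a * ·) (hinv U _).symm)
    have h1 : ι U (f.app U a • φ) = g.app (π ⁻¹ᵁ U) (π.app U a) • ι U φ := by
      refine Subtype.ext ?_
      change μ (f.app U a • φ.1) = g.app (π ⁻¹ᵁ U) (π.app U a) • μ φ.1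
      rw [Algebra.smul_def, Algebra.smul_def, map_mul]
      exact congrArg (· * μ φ.1) (hμ U a)
    exact (congrArg (σ.toHom (π ⁻¹ᵁ U) (hsub U hU)) h1).trans (σ.map_smul _ _ _ _)
  · intro U V _ _ hU hV i φ
    have := hne U
    have := hne V
    refine (app_bijective π hπ V).1 ((hinv V _).trans ?_)
    have h1 := ConcreteCategory.congr_hom (π.naturality i.op)
    refine Eq.trans ?_ (h1 _).symm
    refine Eq.trans ?_ (congrArg (Y.presheaf.map ((Opens.map π.base).map i).op) (hinv U _).symm)
    exact σ.map_restrict _ _ (hsub U hU) (hsub V hV) ((Opens.map π.base).map i) (ι U φ)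
  · intro U _ hU
    have := hne U
    have h1 := one_mem_divisorialSections f hΔ (f ⁻¹ᵁ U)
    refine ⟨h1, (app_bijective π hπ U).1 ((hinv U _).trans ?_)⟩
    obtain ⟨h2, h3⟩ := σ.map_one (π ⁻¹ᵁ U) (hsub U hU)
    rw [map_one, ← h3]
    exact congrArg (σ.toHom (π ⁻¹ᵁ U) (hsub U hU)) (Subtype.ext (map_one μ))

end PlusRegular

/-! ### Descent of strong global `+`-regularity -/

theorem mainTheorem12 {X Y : Scheme.{u}}
    [PlusRegular.IsExcellentScheme X] [PlusRegular.IsNormalScheme X]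
    [PlusRegular.IsExcellentScheme Y] [PlusRegular.IsNormalScheme Y]
    (π : Y ⟶ X) [IsProper π] (hπ : ∀ U : X.Opens, IsIso (π.app U))
    (Δ : AlgebraicCycle X ℚ) (hΔ : PlusRegular.IsEffectiveQCartier Δ)
    (ΔY : AlgebraicCycle Y ℚ) (hΔY : PlusRegular.IsQCartierPullback π Δ ΔY)
    (hY : PlusRegular.IsStronglyGloballyPlusRegular Y ΔY) :
    PlusRegular.IsStronglyGloballyPlusRegular X Δ := by
  intro D hD hD0
  obtain ⟨E, hE, hE0, hEb⟩ := PlusRegular.exists_isPullbackBound π D hπ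
  -- Since `E` is fixed before any cover is chosen, this `ε` serves all finite covers of `X` at
  -- once.
  obtain ⟨ε, hε, hreg⟩ := hY E hE hE0
  refine ⟨ε, hε, ?_⟩
  intro S _ _ _ f _ hf
  obtain ⟨T, _, _, _, g, _, μ, hg, hfg, hμ⟩ := PlusRegular.exists_finite_normal_cover f hf π hπ
  obtain ⟨σ⟩ := hreg T g hg
  refine PlusRegular.nonempty_splitting_of_cover f π hπ g
    (PlusRegular.closure_genericPoint_eq_range f hf ▸ PlusRegular.isOpen_closure_singleton
      ((PlusRegular.closure_genericPoint_eq_range f hf).symm ▸ hf)) hfg μ hμ (fun x => ?_) (fun U _ _ φ hφ =>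
    PlusRegular.mem_divisorialSections_of_cover f hf π hπ g hg hfg.le μ hμ hΔ hΔY hEb hε U hφ) σ
  have h1 : 0 ≤ Δ x := (Function.locallyFinsuppWithin.le_def.1 hΔ.nonneg) x
  have h2 : 0 ≤ D x := (Function.locallyFinsuppWithin.le_def.1 hD0) x
  exact add_nonneg h1 (mul_nonneg hε.le (Int.cast_nonneg h2))
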